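/- Let $n\ge 1$, and let $\mathbb H^n=\mathbb R^{2n}\times\mathbb R$ be the Heisenberg group, with points $z=(x,t)$, group law $(x,t)\circ(\xi,\tau)=(x+\xi,\,t+\tau+2\langle \mathcal Jx,\xi\rangle)$, where $\mathcal J=\begin{pmatrix}0&-I_n\\ I_n&0\end{pmatrix}$, and homogeneous dimension $Q=2n+2$. Let $\rho(x,t)=(|x|^4+t^2)^{1/4}$, $d(z,\zeta)=\rho(z^{-1}\circ\zeta)$ and $B_R(z)=\{\zeta: d(z,\zeta)<R\}$; $|\cdot|$ also denotes Lebesgue measure. Let $X_i=\partial_{x_i}+2(\mathcal Jx)_i\partial_t$ for $i=1,\dots,2n$, $D^2_{\mathbb H}u=\big(\tfrac12(X_iX_ju+X_jX_iu)\big)_{i,j}$ and $\mathcal L_Au=\operatorname{tr}(A(z)D^2_{\mathbb H}u)$. Let $0<\lambda\le\Lambda<\infty$, fix $\delta\in(0,\tfrac12)$, and put $\eta=2\sqrt{\Lambda/\lambda}+1$ and $\alpha=\frac{Q-2}{4}+\delta$. For an open set $\Omega\subseteq\mathbb H^n$, let $M_n(\lambda,\Lambda)$ be the class of $2n\times 2n$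 matrix functions $A$ such that, for every $z\in\Omega$, $A(z)$ is symmetric, $\det A(z)=1$ and $\lambda I\le A(z)\le\Lambda I$. Such an $A$ is called symplectic if $A(z)^{-1}=\mathcal J^tA(z)\mathcal J$ for all $z\in\Omega$ (and $A(z_0)$ is called symplectic if this holds at $z=z_0$). For a nondecreasing $\omega:[0,1)\to[0,1)$ with $\lim_{s\to0^+}\omega(s)=\omega(0)=0$, let $C(\Omega,\omega)$ be the class of continuous matrix functions $A$ on $\Omega$ with $\sup_{z\in B_s(z_0)\cap\Omega}\|A(z)-A(z_0)\|\le\omega(s)$ for all $z_0\in\Omega$ and $0<s<1$, where $\|\cdot\|$ is the operator norm. For a constant matrix $M$ let $\phi_M(x,t)=\langle M^{-1}x,x\rangle^2+t^2$ and $g_M=-\frac1\alpha\phi_M^{-\alpha}$. Call $\epsilon_0>0$ a *subsolution radius* for $(\lambda,\Lambda,\delta,\omega,\Omega)$ if, for all $A\in M_n(\lambda,\Lambda)\cap C(\Omega,\omega)$ and all $z_0\in\Omega$ with $A(z_0)$ symplectic, $$-\operatorname{tr}\big(A(z)\,(D^2_{\mathbb H}g_{A(z_0)})(\zeta)\big)\ge0\qquad\text{for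 all } z\in B_{\epsilon_0}(z_0)\cap\Omega \text{ and all } \zeta\ne0 .$$ **Theorem (critical density).** There is $\epsilon\in(0,1)$, depending only on $Q,\lambda,\Lambda$ (and on the fixed number $\delta$), such that for every $\omega$ as above the following holds. (a) There is $\epsilon_0>0$, depending only on $\lambda,\Lambda,Q,\delta,\omega$, that is a subsolution radius for $(\lambda,\Lambda,\delta,\omega,\Omega)$ for every open $\Omega\subseteq\mathbb H^n$. (b) For every open $\Omega\subseteq\mathbb H^n$, every subsolution radius $\epsilon_0>0$ for $(\lambda,\Lambda,\delta,\omega,\Omega)$, all $z_0\in\Omega$ and $0<r\le\epsilon_0$ with $B_{\eta r}(z_0)\subseteq\Omega$, every symplectic $A\in M_n(\lambda,\Lambda)\cap C(\Omega,\omega)$ and every $u\in C^2(B_{\eta r}(z_0))$ satisfying (i) $u\ge0$ in $B_{\eta r}(z_0)$, (ii) $\mathcal L_Au\le0$ in $B_{\eta r}(z_0)$, (iii) $\inf_{B_{r/2}(z_0)}u<\tfrac12$, one has $$\big|\{z\in B_r(z_0): u(z)<1\}\big|\ \ge\ \epsilon\,|B_r(z_0)| .$$ -/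

import Mathlib

open Set Filter Topology MeasureTheory
open scoped ENNReal Matrix

noncomputable section

namespace Heisenberg

/-- The underlying space `ℝ^{2n} × ℝ` of the Heisenberg group `ℍⁿ`. The `2n` horizontal coordinates
are indexed by `Fin n ⊕ Fin n`, in accordance with the block form of `J`. -/
abbrev Hn (n : ℕ) : Type := EuclideanSpace ℝ (Fin n ⊕ Fin n) × ℝ

/-- Real `2n × 2n` matrices. -/
abbrev Mat (n : ℕ) : Type := Matrix (Fin n ⊕ Fin n) (Fin n ⊕ Fin n) ℝ

/-- The vector `J x`, where `J = [[0, -I], [I, 0]]`. -/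
def Jvec {n : ℕ} (x : EuclideanSpace ℝ (Fin n ⊕ Fin n)) : EuclideanSpace ℝ (Fin n ⊕ Fin n) :=
  WithLp.toLp 2 (Matrix.J (Fin n) ℝ *ᵥ WithLp.ofLp x)

/-- The group law `(x,t) ∘ (ξ,τ) = (x + ξ, t + τ + 2⟨J x, ξ⟩)`. -/
def gmul {n : ℕ} (z ζ : Hn n) : Hn n :=
  (z.1 + ζ.1, z.2 + ζ.2 + 2 * inner ℝ (Jvec z.1) ζ.1)

/-- The group inverse `(x,t)⁻¹ = (-x,-t)`. -/
def ginv {n : ℕ} (z : Hn n) : Hn n := (-z.1, -z.2)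

/-- The homogeneous norm `ρ(x,t) = (|x|⁴ + t²)^{1/4}`. -/
def rho {n : ℕ} (z : Hn n) : ℝ := (‖z.1‖ ^ 4 + z.2 ^ 2) ^ (1 / 4 : ℝ)

/-- The distance `d(z,ζ) = ρ(z⁻¹ ∘ ζ)`. -/
def kdist {n : ℕ} (z ζ : Hn n) : ℝ := rho (gmul (ginv z) ζ)

/-- The Koranyi ball `B_R(z)`. -/
def kball {n : ℕ} (z : Hn n) (R : ℝ) : Set (Hn n) := {ζ | kdist z ζ < R}

/-- The homogeneous dimension `Q = 2n + 2`, as a real number. -/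
def homDim (n : ℕ) : ℝ := 2 * n + 2

/-- The horizontal vector field `X_i = ∂_{x_i} + 2 (J x)_i ∂_t` applied to `ψ`. -/
def X {n : ℕ} (i : Fin n ⊕ Fin n) (ψ : Hn n → ℝ) (z : Hn n) : ℝ :=
  fderiv ℝ ψ z (EuclideanSpace.single i 1, 2 * Jvec z.1 i)

/-- The (symmetrized) horizontal Hessian, with entries `(X_i X_j ψ + X_j X_i ψ) / 2`. -/
def horHess {n : ℕ} (ψ : Hn n → ℝ) (z : Hn n) : Mat n :=
  Matrix.of fun i j => (1 / 2 : ℝ) * (X i (X j ψ) z + X j (X i ψ) z)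

/-- The operator `𝓛_A ψ (z) = tr (A(z) D²_ℍ ψ(z))`. -/
def opL {n : ℕ} (A : Hn n → Mat n) (ψ : Hn n → ℝ) (z : Hn n) : ℝ :=
  Matrix.trace (A z * horHess ψ z)

/-- The class `M_n(λ, Λ, Ω)`: `A(z)` is symmetric, `λ I ≤ A(z) ≤ Λ I` and `det A(z) = 1` for every
`z ∈ Ω`. -/
structure MemM {n : ℕ} (lam Lam : ℝ) (Ω : Set (Hn n)) (A : Hn n → Mat n) : Prop where
  symm : ∀ z ∈ Ω, (A z).IsSymm
  lower : ∀ z ∈ Ω, (A z - lam • (1 : Mat n)).PosSemidef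
  upper : ∀ z ∈ Ω, (Lam • (1 : Mat n) - A z).PosSemidef
  det_eq_one : ∀ z ∈ Ω, (A z).det = 1

/-- The symplectic condition `M⁻¹ = Jᵗ M J` for a constant matrix. -/
def IsSymplectic {n : ℕ} (M : Mat n) : Prop :=
  M⁻¹ = (Matrix.J (Fin n) ℝ)ᵀ * M * Matrix.J (Fin n) ℝ

/-- The modulus of continuity `ω_A(z₀; ε) = sup_{z ∈ B_ε(z₀) ∩ Ω} ‖A(z) - A(z₀)‖` (operator norm),
with values in `[0, ∞]`. -/
def modulus {n : ℕ} (Ω : Set (Hn n)) (A : Hn n → Mat n) (z₀ : Hn n) (ε : ℝ) : ℝ≥0∞ :=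
  ⨆ z ∈ kball z₀ ε ∩ Ω, ENNReal.ofReal ‖Matrix.toEuclideanCLM (𝕜 := ℝ) (A z - A z₀)‖

/-- `ω : [0,1) → [0,1)` is nondecreasing with `lim_{s → 0⁺} ω(s) = ω(0) = 0`. The values of `ω`
outside `[0,1)` play no role. -/
structure IsModulus (ω : ℝ → ℝ) : Prop where
  mapsTo : MapsTo ω (Ico 0 1) (Ico 0 1)
  mono : MonotoneOn ω (Ico 0 1)
  zero : ω 0 = 0
  tendsto : Tendsto ω (𝓝[>] 0) (𝓝 0)

/-- The class `C(Ω, ω)`. -/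
structure MemC {n : ℕ} (Ω : Set (Hn n)) (ω : ℝ → ℝ) (A : Hn n → Mat n) : Prop where
  continuousOn : ContinuousOn A Ω
  modulus_le : ∀ z₀ ∈ Ω, ∀ ε : ℝ, 0 < ε → ε < 1 → modulus Ω A z₀ ε ≤ ENNReal.ofReal (ω ε)

/-- `φ_M(x,t) = ⟨M⁻¹ x, x⟩² + t²`. -/
def phi {n : ℕ} (M : Mat n) (z : Hn n) : ℝ :=
  ((M⁻¹ *ᵥ WithLp.ofLp z.1) ⬝ᵥ WithLp.ofLp z.1) ^ 2 + z.2 ^ 2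

/-- The exponent `α = (Q - 2)/4 + δ`. -/
def expo (n : ℕ) (δ : ℝ) : ℝ := (homDim n - 2) / 4 + δ

/-- The kernel `g(ζ) = -(1/α) φ_M(ζ)^{-α}`, used only for `ζ ≠ 0`. -/
def kernelG {n : ℕ} (M : Mat n) (δ : ℝ) (ζ : Hn n) : ℝ :=
  -(1 / expo n δ) * phi M ζ ^ (-expo n δ)

/-- `ε₀` is a subsolution radius for the data `λ, Λ, δ, ω, Ω`: for all `A ∈ M_n(λ,Λ,Ω) ∩ C(Ω,ω)` and
all `z₀ ∈ Ω` at which `A(z₀)` is symplectic, the kernel `g` of the constant matrix `M = A(z₀)`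
satisfies `-tr (A(z) D²_ℍ g(ζ)) ≥ 0` for all `z ∈ B_{ε₀}(z₀) ∩ Ω` and all `ζ ≠ 0`. -/
def IsSubsolutionRadius {n : ℕ} (lam Lam δ : ℝ) (ω : ℝ → ℝ) (Ω : Set (Hn n)) (ε₀ : ℝ) : Prop :=
  ∀ A : Hn n → Mat n, MemM lam Lam Ω A → MemC Ω ω A →
    ∀ z₀ ∈ Ω, IsSymplectic (A z₀) →
      ∀ z ∈ kball z₀ ε₀ ∩ Ω, ∀ ζ : Hn n, ζ ≠ 0 →
        0 ≤ -Matrix.trace (A z * horHess (kernelG (A z₀) δ) ζ)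

/-- The dilation factor `η = 2 √(Λ/λ) + 1`. -/
def eta (lam Lam : ℝ) : ℝ := 2 * Real.sqrt (Lam / lam) + 1

end Heisenberg

end

noncomputable section

namespace Heisenberg

variable {n : ℕ}

/-! Part (b) is a barrier argument by contradiction. Suppose `{u < 1}` fills less than the fraction
`ε` of `B_r(z₀)`, and pick `z₁ ∈ B_{r/2}(z₀)` with `u z₁ < 1/2`. Let `G` be a small ball about `z₁`
for the gauge `φ` of the frozen matrix `A(z₀)`, and let `S` be the part of `G` where `u ≥ 1`. The
barrier is the potential of `S` with kernel `φ^{-α}`, which is locally integrable because `δ < 1/2`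
means `4α < Q`. Among sets of the volume of `G`, the bathtub principle makes the centre value of `G`
maximal; at distance `r/4` from `S` the potential is definitely smaller; and as `G \ S` is tiny, it
is nearly maximal at `z₁`. This is `exists_potential_bounds`, with constants depending only on `n`,
`α` and the ellipticity bounds. An affine change yields `h` with `h ≤ 1` off `S`, `h ≤ 0` on the
sphere of radius `r`, and `h z₁ ≥ 7/8`. `comparison`, run where `u ≤ 3/4` and hence away from `S`,
gives `h z₁ < 7/8`.

That `h` is a subsolution off `S` comes from the left invariance of the `X_i` and the subsolution
radius, which lets the coefficient point `z` and the kernel point `ζ` vary independently.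
Subsolutions are tested by symmetric second differences along the rows of `B`, where `A(z) = BᵀB`;
these pass through the integral over `S`, so the potential is never differentiated (`isSubAt_rpot`,
`not_isLocalMin_sub`).

Part (a) is an explicit computation: when `A(z) = A(z₀)` is symplectic, the excess `δ` over the
exponent `(Q-2)/4` leaves a strict margin proportional to `δ`, which absorbs a small oscillation of
`A` (`perturbation_le`). -/

lemma inner_eq_dotProduct {ι : Type*} [Fintype ι] (x y : EuclideanSpace ℝ ι) :
    inner ℝ x y = WithLp.ofLp x ⬝ᵥ WithLp.ofLp y := by
  rw [EuclideanSpace.inner_eq_star_dotProduct, dotProduct_comm]; simp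

/-! ### The map `J` and the group law -/

lemma Jvec_add (x y : EuclideanSpace ℝ (Fin n ⊕ Fin n)) : Jvec (x + y) = Jvec x + Jvec y := by
  simp [Jvec, Matrix.mulVec_add]

lemma Jvec_smul (c : ℝ) (x : EuclideanSpace ℝ (Fin n ⊕ Fin n)) : Jvec (c • x) = c • Jvec x := by
  simp [Jvec, Matrix.mulVec_smul]

lemma Jvec_neg (x : EuclideanSpace ℝ (Fin n ⊕ Fin n)) : Jvec (-x) = -Jvec x := by
  simp [Jvec, Matrix.mulVec_neg]

lemma Jvec_zero : Jvec (0 : EuclideanSpace ℝ (Fin n ⊕ Fin n)) = 0 := by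
  simp [Jvec]

/-- `J` as a linear map. -/
def JvecL (n : ℕ) : EuclideanSpace ℝ (Fin n ⊕ Fin n) →L[ℝ] EuclideanSpace ℝ (Fin n ⊕ Fin n) :=
  LinearMap.toContinuousLinearMap
    { toFun := Jvec, map_add' := Jvec_add, map_smul' := Jvec_smul }

lemma JvecL_apply (x : EuclideanSpace ℝ (Fin n ⊕ Fin n)) : JvecL n x = Jvec x := rfl

@[fun_prop]
lemma continuous_Jvec : Continuous (Jvec : EuclideanSpace ℝ (Fin n ⊕ Fin n) → _) :=
  (JvecL n).continuous

lemma inner_Jvec_left (x y : EuclideanSpace ℝ (Fin n ⊕ Fin n)) :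
    inner ℝ (Jvec x) y = -inner ℝ (Jvec y) x := by
  rw [inner_eq_dotProduct, inner_eq_dotProduct, Jvec, Jvec]
  simp only
  rw [dotProduct_comm, Matrix.dotProduct_mulVec, ← Matrix.mulVec_transpose, Matrix.J_transpose,
    Matrix.neg_mulVec, neg_dotProduct]

lemma inner_Jvec_self (x : EuclideanSpace ℝ (Fin n ⊕ Fin n)) : inner ℝ (Jvec x) x = 0 := by
  have := inner_Jvec_left x x
  linarith

lemma Jvec_Jvec (x : EuclideanSpace ℝ (Fin n ⊕ Fin n)) : Jvec (Jvec x) = -x := by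
  simp [Jvec, Matrix.mulVec_mulVec, Matrix.J_squared, Matrix.neg_mulVec]

lemma norm_Jvec (x : EuclideanSpace ℝ (Fin n ⊕ Fin n)) : ‖Jvec x‖ = ‖x‖ := by
  have h : ‖Jvec x‖ ^ 2 = ‖x‖ ^ 2 := by
    rw [← real_inner_self_eq_norm_sq, ← real_inner_self_eq_norm_sq, inner_Jvec_left, Jvec_Jvec,
      inner_neg_left, neg_neg]
  exact (sq_eq_sq₀ (norm_nonneg _) (norm_nonneg _)).1 h

lemma gmul_assoc (a b c : Hn n) : gmul (gmul a b) c = gmul a (gmul b c) := by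
  ext1
  · simp [gmul, add_assoc]
  · simp only [gmul, Jvec_add, inner_add_left, inner_add_right]; ring

lemma gmul_zero (a : Hn n) : gmul a 0 = a := by ext1 <;> simp [gmul]

lemma zero_gmul (a : Hn n) : gmul 0 a = a := by ext1 <;> simp [gmul, Jvec_zero]

lemma gmul_ginv (a : Hn n) : gmul a (ginv a) = 0 := by
  ext1
  · simp [gmul, ginv]
  · simp [gmul, ginv, inner_Jvec_self]

lemma ginv_gmul (a : Hn n) : gmul (ginv a) a = 0 := by
  ext1
  · simp [gmul, ginv]
  · simp [gmul, ginv, Jvec_neg, inner_Jvec_self]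

lemma ginv_ginv (a : Hn n) : ginv (ginv a) = a := by ext1 <;> simp [ginv]

lemma ginv_gmul_cancel_left (a b : Hn n) : gmul (ginv a) (gmul a b) = b := by
  rw [← gmul_assoc, ginv_gmul, zero_gmul]

lemma gmul_ginv_cancel_left (a b : Hn n) : gmul a (gmul (ginv a) b) = b := by
  rw [← gmul_assoc, gmul_ginv, zero_gmul]

lemma ginv_gmul_rev (a b : Hn n) : ginv (gmul a b) = gmul (ginv b) (ginv a) := by
  ext1
  · simp [gmul, ginv, add_comm]
  · simp only [gmul, ginv, Jvec_neg, inner_neg_neg]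
    rw [inner_Jvec_left b.1 a.1]; ring

lemma ginv_gmul_eq_zero {a b : Hn n} (h : gmul (ginv a) b = 0) : a = b := by
  rw [← gmul_ginv_cancel_left a b, h, gmul_zero]

@[fun_prop]
lemma continuous_gmul {α : Type*} [TopologicalSpace α] {f g : α → Hn n} (hf : Continuous f)
    (hg : Continuous g) : Continuous fun a => gmul (f a) (g a) := by
  unfold Heisenberg.gmul; fun_prop

@[fun_prop]
lemma continuous_ginv {α : Type*} [TopologicalSpace α] {f : α → Hn n} (hf : Continuous f) :
    Continuous fun a => ginv (f a) := by
  unfold Heisenberg.ginv; fun_prop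

lemma gmul_smul_line (z : Hn n) (b : EuclideanSpace ℝ (Fin n ⊕ Fin n)) (s : ℝ) :
    gmul z (s • b, 0) = z + s • (b, 2 * inner ℝ (Jvec z.1) b) := by
  ext1
  · simp [gmul]
  · simp [gmul, inner_smul_right]; ring

/-! ### The homogeneous norm -/

lemma rho_pow_four (z : Hn n) : rho z ^ 4 = ‖z.1‖ ^ 4 + z.2 ^ 2 := by
  rw [rho, ← Real.rpow_natCast, ← Real.rpow_mul (by positivity)]; norm_num

lemma rho_nonneg (z : Hn n) : 0 ≤ rho z := by unfold rho; positivity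

@[fun_prop]
lemma continuous_rho : Continuous (rho : Hn n → ℝ) := by
  unfold rho
  exact Continuous.rpow_const (by fun_prop) (fun _ => Or.inr (by norm_num))

lemma rho_zero : rho (0 : Hn n) = 0 := by
  have h := rho_pow_four (0 : Hn n)
  simpa using h

lemma rho_ginv (z : Hn n) : rho (ginv z) = rho z := by simp [rho, ginv]

lemma norm_fst_le_rho (z : Hn n) : ‖z.1‖ ≤ rho z := by
  refine (pow_le_pow_iff_left₀ (norm_nonneg _) (rho_nonneg z) (n := 4) (by norm_num)).1 ?_
  rw [rho_pow_four]; nlinarith [sq_nonneg z.2]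

lemma abs_snd_le_rho_sq (z : Hn n) : |z.2| ≤ rho z ^ 2 := by
  refine abs_le_of_sq_le_sq ?_ (by positivity)
  have := rho_pow_four z
  nlinarith [pow_nonneg (norm_nonneg z.1) 4]

/-- Bessel's inequality for the orthogonal vectors `x` and `Jx` of equal length, obtained from
Cauchy–Schwarz for `p x + q Jx` against `y`. -/
lemma inner_sq_add_inner_Jvec_sq_le (x y : EuclideanSpace ℝ (Fin n ⊕ Fin n)) :
    inner ℝ x y ^ 2 + inner ℝ (Jvec x) y ^ 2 ≤ (‖x‖ * ‖y‖) ^ 2 := by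
  set p := inner ℝ x y with hp
  set q := inner ℝ (Jvec x) y with hq
  have h : inner ℝ (p • x + q • Jvec x) y = p ^ 2 + q ^ 2 := by
    rw [inner_add_left, real_inner_smul_left, real_inner_smul_left]; ring
  have hn : ‖p • x + q • Jvec x‖ ^ 2 = (p ^ 2 + q ^ 2) * ‖x‖ ^ 2 := by
    rw [norm_add_sq_real, real_inner_smul_left, real_inner_smul_right, real_inner_comm,
      inner_Jvec_self, norm_smul, norm_smul, norm_Jvec, mul_pow, mul_pow]
    simp only [Real.norm_eq_abs, sq_abs]; ring
  have hcs := real_inner_le_norm (p • x + q • Jvec x) y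
  rw [h] at hcs
  have h2 : (p ^ 2 + q ^ 2) ^ 2 ≤ (p ^ 2 + q ^ 2) * (‖x‖ * ‖y‖) ^ 2 := by
    calc (p ^ 2 + q ^ 2) ^ 2 ≤ (‖p • x + q • Jvec x‖ * ‖y‖) ^ 2 :=
          pow_le_pow_left₀ (by positivity) hcs 2
      _ = _ := by rw [mul_pow, hn]; ring
  rcases (show 0 ≤ p ^ 2 + q ^ 2 by positivity).eq_or_lt with h0 | h0
  · rw [← h0]; positivity
  · rw [sq (p ^ 2 + q ^ 2)] at h2
    exact le_of_mul_le_mul_left h2 h0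

lemma rho_eq_zero {z : Hn n} : rho z = 0 ↔ z = 0 := by
  refine ⟨fun h => ?_, fun h => h ▸ rho_zero⟩
  have h1 := norm_fst_le_rho z
  have h2 := abs_snd_le_rho_sq z
  rw [h] at h1 h2
  ext1
  · exact norm_le_zero_iff.1 h1
  · exact abs_nonpos_iff.1 (by simpa using h2)

lemma rho_pos {z : Hn n} (h : z ≠ 0) : 0 < rho z :=
  (rho_nonneg z).lt_of_ne fun h0 => h (rho_eq_zero.1 h0.symm)

/-- Cygan's inequality. -/
lemma rho_gmul_le (z w : Hn n) : rho (gmul z w) ≤ rho z + rho w := by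
  refine (pow_le_pow_iff_left₀ (rho_nonneg _) (add_nonneg (rho_nonneg z) (rho_nonneg w))
    (n := 4) (by norm_num)).1 ?_
  rw [rho_pow_four]
  have hx := norm_fst_le_rho z
  have hy := norm_fst_le_rho w
  have hz4 := rho_pow_four z
  have hw4 := rho_pow_four w
  have hz0 := rho_nonneg z
  have hw0 := rho_nonneg w
  have hpq := inner_sq_add_inner_Jvec_sq_le z.1 w.1
  simp only [gmul]
  have hn : ‖z.1 + w.1‖ ^ 4 = (‖z.1‖ ^ 2 + 2 * inner ℝ z.1 w.1 + ‖w.1‖ ^ 2) ^ 2 := by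
    rw [← norm_add_sq_real]; ring
  rw [hn]
  set p := inner ℝ z.1 w.1
  set q := inner ℝ (Jvec z.1) w.1
  set X := ‖z.1‖
  set Y := ‖w.1‖
  have hX : 0 ≤ X := norm_nonneg _
  have hY : 0 ≤ Y := norm_nonneg _
  set a := rho z
  set b := rho w
  set t := z.2
  set s := w.2
  have hXY : X * Y ≤ a * b := mul_le_mul hx hy hY hz0
  have hpq' : p ^ 2 + q ^ 2 ≤ (a * b) ^ 2 :=
    hpq.trans (pow_le_pow_left₀ (by positivity) hXY 2)
  have hab : 0 ≤ a * b := by positivity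
  -- The fourth power of the left side expands into `a⁴ + b⁴` plus mixed terms. Each mixed term is a
  -- planar inner product, so Cauchy–Schwarz bounds it by the matching term of `(a + b)⁴`.
  have cross : ∀ u v c : ℝ, 0 ≤ c → u ^ 2 + v ^ 2 = c ^ 2 → u * p + v * q ≤ c * (a * b) := by
    intro u v c hc h
    refine abs_le_of_sq_le_sq' ?_ (by positivity) |>.2
    calc (u * p + v * q) ^ 2 ≤ (u ^ 2 + v ^ 2) * (p ^ 2 + q ^ 2) := by
          nlinarith [sq_nonneg (u * q - v * p)]
      _ ≤ (u ^ 2 + v ^ 2) * (a * b) ^ 2 := by gcongr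
      _ = _ := by rw [h]; ring
  have c1 := cross (X ^ 2) t (a ^ 2) (by positivity) (by linear_combination -hz4)
  have c2 := cross (Y ^ 2) s (b ^ 2) (by positivity) (by linear_combination -hw4)
  have c3 : X ^ 2 * Y ^ 2 + t * s ≤ a ^ 2 * b ^ 2 := by
    refine abs_le_of_sq_le_sq' ?_ (by positivity) |>.2
    calc (X ^ 2 * Y ^ 2 + t * s) ^ 2 ≤ (X ^ 4 + t ^ 2) * (Y ^ 4 + s ^ 2) := by
          nlinarith [sq_nonneg (X ^ 2 * s - Y ^ 2 * t)]
      _ = _ := by rw [← hz4, ← hw4]; ring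
  nlinarith

lemma kdist_eq_zero_self (z : Hn n) : kdist z z = 0 := by rw [kdist, ginv_gmul, rho_zero]

lemma kdist_comm (z w : Hn n) : kdist z w = kdist w z := by
  rw [kdist, kdist, ← rho_ginv, ginv_gmul_rev, ginv_ginv]

lemma kdist_triangle (a b c : Hn n) : kdist a c ≤ kdist a b + kdist b c := by
  have h : gmul (ginv a) c = gmul (gmul (ginv a) b) (gmul (ginv b) c) := by
    rw [gmul_assoc, gmul_ginv_cancel_left]
  rw [kdist, h]; exact rho_gmul_le _ _

@[fun_prop]
lemma continuous_kdist (z : Hn n) : Continuous (kdist z) := by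
  unfold kdist; fun_prop

lemma isOpen_kball (z : Hn n) (R : ℝ) : IsOpen (kball z R) :=
  isOpen_lt (continuous_kdist z) continuous_const

lemma isBounded_rho_le (R : ℝ) : Bornology.IsBounded {z : Hn n | rho z ≤ R} := by
  refine (isBounded_iff_forall_norm_le).2 ⟨max R (R ^ 2), fun z hz => ?_⟩
  have hz' : rho z ≤ R := hz
  refine max_le_max ((norm_fst_le_rho z).trans hz') ?_
  exact (abs_snd_le_rho_sq z).trans (pow_le_pow_left₀ (rho_nonneg z) hz' 2)

lemma isCompact_rho_le (R : ℝ) : IsCompact {z : Hn n | rho z ≤ R} :=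
  Metric.isCompact_of_isClosed_isBounded (isClosed_le continuous_rho continuous_const)
    (isBounded_rho_le R)

lemma isCompact_kdist_le (z : Hn n) (R : ℝ) : IsCompact {w : Hn n | kdist z w ≤ R} := by
  have : {w : Hn n | kdist z w ≤ R} = gmul z '' {w | rho w ≤ R} := by
    ext w
    constructor
    · intro h
      exact ⟨gmul (ginv z) w, h, gmul_ginv_cancel_left z w⟩
    · rintro ⟨v, hv, rfl⟩
      simpa [kdist, ginv_gmul_cancel_left] using hv
  rw [this]
  exact (isCompact_rho_le R).image (by fun_prop)

/-! ### Invariance of Lebesgue measure -/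

instance instIsAddHaarMeasureHn : (volume : Measure (Hn n)).IsAddHaarMeasure :=
  inferInstanceAs (Measure.prod volume volume).IsAddHaarMeasure

/-- A left translation is a shear: it shifts `x` by a constant and `t` by an amount depending on `x`
alone. -/
lemma measurePreserving_gmul (z : Hn n) : MeasurePreserving (gmul z) volume volume := by
  have h := (measurePreserving_add_left (volume : Measure (EuclideanSpace ℝ (Fin n ⊕ Fin n)))
    z.1).skew_product (μc := (volume : Measure ℝ)) (μd := (volume : Measure ℝ))
    (g := fun x t => (z.2 + 2 * inner ℝ (Jvec z.1) x) + t) (by fun_prop)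
    (ae_of_all _ fun x => map_add_left_eq_self _ _)
  have heq : gmul z = fun p : Hn n => (z.1 + p.1, (z.2 + 2 * inner ℝ (Jvec z.1) p.1) + p.2) := by
    funext p
    simp only [gmul, Prod.mk.injEq, true_and]; ring
  rw [heq]
  exact h

lemma measurePreserving_ginv : MeasurePreserving (ginv : Hn n → Hn n) volume volume :=
  Measure.measurePreserving_neg (volume : Measure (Hn n))

lemma measurePreserving_ginv_gmul (z : Hn n) :
    MeasurePreserving (fun w => gmul (ginv w) z) volume volume := by
  have h := measurePreserving_ginv.comp (measurePreserving_gmul (ginv z))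
  have heq : (fun w => gmul (ginv w) z) = ginv ∘ gmul (ginv z) := by
    funext w
    simp [ginv_gmul_rev, ginv_ginv]
  rw [heq]
  exact h

/-- The anisotropic dilation `(x,t) ↦ (R x, R² t)`. -/
def dil (n : ℕ) (R : ℝ) : Hn n →ₗ[ℝ] Hn n :=
  LinearMap.prodMap (R • LinearMap.id) (R ^ 2 • LinearMap.id)

lemma dil_apply (R : ℝ) (z : Hn n) : dil n R z = (R • z.1, R ^ 2 * z.2) := rfl

lemma det_dil (R : ℝ) : LinearMap.det (dil n R) = R ^ (2 * n + 2) := by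
  rw [dil, LinearMap.det_prodMap, LinearMap.det_smul, LinearMap.det_smul]
  simp; ring

lemma volume_dil_image (R : ℝ) (hR : 0 ≤ R) (s : Set (Hn n)) :
    volume (dil n R '' s) = ENNReal.ofReal (R ^ (2 * n + 2)) * volume s := by
  rw [Measure.addHaar_image_linearMap, det_dil, abs_of_nonneg (by positivity)]

/-! ### Horizontal second derivatives and second differences -/

/-- Second order Taylor expansion for symmetric differences, locally uniform in the base point. -/
lemma eventually_secondDifference {E : Type*} [NormedAddCommGroup E] [NormedSpace ℝ E]
    {ψ : E → ℝ} {w : E} (hψ : ContDiffAt ℝ 2 ψ w) {η : ℝ} (hη : 0 < η) :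
    ∀ᶠ p : E × E in 𝓝 (w, 0),
      |ψ (p.1 + p.2) + ψ (p.1 - p.2) - 2 * ψ p.1 - fderiv ℝ (fderiv ℝ ψ) w p.2 p.2|
        ≤ η * ‖p.2‖ ^ 2 := by
  set D := fderiv ℝ (fderiv ℝ ψ) w with hD
  have hsymm : ∀ u v, D u v = D v u := by
    have := hψ.isSymmSndFDerivAt (by simp)
    exact fun u v => this u v
  have h1 : ContDiffAt ℝ 1 (fderiv ℝ ψ) w := hψ.fderiv_right (by norm_num)
  -- Strict differentiability of the gradient at `w` makes the estimate uniform in the base point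
  -- `p.1`: it compares gradients at the two moving points `p.1 ± e`, and the mean value inequality
  -- in `e` finishes.
  have hst : HasStrictFDerivAt (fderiv ℝ ψ) D w := h1.hasStrictFDerivAt (by simp)
  have ho := hst.isLittleO.def (half_pos hη)
  have hd : ∀ᶠ x in 𝓝 w, DifferentiableAt ℝ ψ x := by
    filter_upwards [hψ.eventually (by simp)] with x hx using hx.differentiableAt (by simp)
  obtain ⟨r₁, hr₁, H₁⟩ := Metric.eventually_nhds_iff.1 hd
  obtain ⟨r₂, hr₂, H₂⟩ := Metric.eventually_nhds_iff.1 ho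
  have hr : 0 < min r₁ r₂ / 2 := by positivity
  filter_upwards [Metric.ball_mem_nhds (w, (0 : E)) hr] with p hp
  have hp1 : ‖p.1 - w‖ < min r₁ r₂ / 2 := by
    have := (max_lt_iff.1 (show max (dist p.1 w) (dist p.2 0) < _ from hp)).1
    rwa [dist_eq_norm] at this
  have hp2 : ‖p.2‖ < min r₁ r₂ / 2 := by
    have := (max_lt_iff.1 (show max (dist p.1 w) (dist p.2 0) < _ from hp)).2
    rwa [dist_zero_right] at this
  have near : ∀ e : E, ‖e‖ ≤ ‖p.2‖ → dist (p.1 + e) w < min r₁ r₂ := by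
    intro e he
    rw [dist_eq_norm, add_sub_right_comm]
    linarith [norm_add_le (p.1 - w) e]
  have hderiv : ∀ e ∈ Metric.closedBall (0 : E) ‖p.2‖,
      HasFDerivWithinAt (fun e => ψ (p.1 + e) + ψ (p.1 - e) - D e e)
        (fderiv ℝ ψ (p.1 + e) - fderiv ℝ ψ (p.1 - e) - D ((p.1 + e) - (p.1 - e)))
        (Metric.closedBall (0 : E) ‖p.2‖) e := by
    intro e he
    have he' : ‖e‖ ≤ ‖p.2‖ := by simpa using he
    have a1 := (H₁ ((near e he').trans_le (min_le_left _ _))).hasFDerivAt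
    have a2 := (H₁ ((near (-e) (by simpa using he')).trans_le (min_le_left _ _))).hasFDerivAt
    rw [← sub_eq_add_neg] at a2
    have b1 := a1.comp e ((hasFDerivAt_id e).const_add p.1)
    have b2 := a2.comp e ((hasFDerivAt_id e).const_sub p.1)
    have b3 := (D.hasFDerivAt (x := e)).clm_apply (hasFDerivAt_id e)
    refine (((b1.add b2).sub b3).congr_fderiv ?_).hasFDerivWithinAt
    ext v
    simp only [add_sub_sub_cancel, map_add, id_eq]
    simp [hsymm v e]
    ring
  have hbound : ∀ e ∈ Metric.closedBall (0 : E) ‖p.2‖,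
      ‖fderiv ℝ ψ (p.1 + e) - fderiv ℝ ψ (p.1 - e) - D ((p.1 + e) - (p.1 - e))‖ ≤ η * ‖p.2‖ := by
    intro e he
    have he' : ‖e‖ ≤ ‖p.2‖ := by simpa using he
    have := @H₂ (p.1 + e, p.1 - e) (by
      refine max_lt ((near e he').trans_le (min_le_right _ _)) ?_
      rw [sub_eq_add_neg]
      exact (near (-e) (by simpa using he')).trans_le (min_le_right _ _))
    refine this.trans ?_
    simp only [add_sub_sub_cancel]
    have : ‖e + e‖ ≤ 2 * ‖p.2‖ := by linarith [norm_add_le e e]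
    nlinarith
  have key := (convex_closedBall (0 : E) ‖p.2‖).norm_image_sub_le_of_norm_hasFDerivWithin_le
    hderiv hbound (x := 0) (y := p.2) (by simp) (by simp)
  rw [Real.norm_eq_abs] at key
  simp only [add_zero, sub_zero, map_zero] at key
  rw [show ψ (p.1 + p.2) + ψ (p.1 - p.2) - 2 * ψ p.1 - D p.2 p.2
    = ψ (p.1 + p.2) + ψ (p.1 - p.2) - D p.2 p.2 - (ψ p.1 + ψ p.1) by ring]
  linarith [key, sq ‖p.2‖]

/-- The horizontal vector `(b, 2⟨J x, b⟩)` at the point `(x,t)`. -/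
def hvec (b : EuclideanSpace ℝ (Fin n ⊕ Fin n)) (z : Hn n) : Hn n :=
  (b, 2 * inner ℝ (Jvec z.1) b)

lemma hvec_eq_sum (b : EuclideanSpace ℝ (Fin n ⊕ Fin n)) (z : Hn n) :
    hvec b z = ∑ i, b i • hvec (EuclideanSpace.single i 1) z := by
  have hb : b = ∑ i, b i • EuclideanSpace.single i (1 : ℝ) := by
    ext j
    simp only [WithLp.ofLp_sum, WithLp.ofLp_smul, Finset.sum_apply, Pi.smul_apply,
      PiLp.single_apply, smul_eq_mul, mul_ite, mul_one, mul_zero, Finset.sum_ite_eq,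
      Finset.mem_univ, if_true]
  let f : EuclideanSpace ℝ (Fin n ⊕ Fin n) →ₗ[ℝ] Hn n :=
    { toFun := fun b => hvec b z
      map_add' := by intro x y; ext1 <;> simp [hvec, inner_add_right, mul_add]
      map_smul' := by intro c x; ext1 <;> simp [hvec, inner_smul_right]; ring }
  calc hvec b z = f b := rfl
    _ = f (∑ i, b i • EuclideanSpace.single i (1 : ℝ)) := by rw [← hb]
    _ = _ := by rw [map_sum]; simp only [map_smul]; rfl

lemma X_eq (i : Fin n ⊕ Fin n) (ψ : Hn n → ℝ) (z : Hn n) :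
    X i ψ z = fderiv ℝ ψ z (hvec (EuclideanSpace.single i 1) z) := by
  have : inner ℝ (Jvec z.1) (EuclideanSpace.single i (1 : ℝ)) = Jvec z.1 i := by
    simp [inner_eq_dotProduct]
  rw [X, hvec, this]

lemma hasFDerivAt_hvec (b : EuclideanSpace ℝ (Fin n ⊕ Fin n)) (z : Hn n) :
    HasFDerivAt (hvec b)
      (ContinuousLinearMap.prod (0 : Hn n →L[ℝ] EuclideanSpace ℝ (Fin n ⊕ Fin n))
        ((2 : ℝ) • ((innerSL ℝ b).comp ((JvecL n).comp (ContinuousLinearMap.fst ℝ _ ℝ))))) z := by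
  refine (hasFDerivAt_const b z).prodMk ?_
  have := (((2 : ℝ) • ((innerSL ℝ b).comp ((JvecL n).comp
    (ContinuousLinearMap.fst ℝ _ ℝ)))) : Hn n →L[ℝ] ℝ).hasFDerivAt (x := z)
  refine this.congr_of_eventuallyEq (Eventually.of_forall fun w => ?_)
  simp [JvecL_apply, real_inner_comm]

lemma fderiv_hvec (b : EuclideanSpace ℝ (Fin n ⊕ Fin n)) (z v : Hn n) :
    fderiv ℝ (hvec b) z v = (0, 2 * inner ℝ (Jvec v.1) b) := by
  rw [(hasFDerivAt_hvec b z).fderiv]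
  simp [JvecL_apply, real_inner_comm]

/-- The first-order term is the derivative of the coefficients of `X_j` along `X_i`, that is, the
contribution of the commutator. -/
lemma X_X_eq {ψ : Hn n → ℝ} {z : Hn n} (hψ : ContDiffAt ℝ 2 ψ z) (i j : Fin n ⊕ Fin n) :
    X i (X j ψ) z = fderiv ℝ (fderiv ℝ ψ) z (hvec (EuclideanSpace.single i 1) z)
        (hvec (EuclideanSpace.single j 1) z)
      + fderiv ℝ ψ z (0, 2 * inner ℝ (Jvec (EuclideanSpace.single i (1 : ℝ)))
          (EuclideanSpace.single j (1 : ℝ))) := by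
  have h1 : DifferentiableAt ℝ (fderiv ℝ ψ) z :=
    (hψ.fderiv_right (m := 1) (by norm_num)).differentiableAt (by simp)
  have h2 : DifferentiableAt ℝ (hvec (EuclideanSpace.single j (1 : ℝ))) z :=
    (hasFDerivAt_hvec _ z).differentiableAt
  have hX : X j ψ = fun z => fderiv ℝ ψ z (hvec (EuclideanSpace.single j 1) z) :=
    funext fun z => X_eq j ψ z
  rw [X_eq, hX, fderiv_clm_apply h1 h2]
  simp only [add_apply, ContinuousLinearMap.comp_apply,
    ContinuousLinearMap.flip_apply, fderiv_hvec]
  rw [add_comm]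
  rfl

/-- The first-order terms are antisymmetric in `i, j`, since `J` is, and cancel on symmetrizing. -/
lemma horHess_apply {ψ : Hn n → ℝ} {z : Hn n} (hψ : ContDiffAt ℝ 2 ψ z) (i j : Fin n ⊕ Fin n) :
    horHess ψ z i j = fderiv ℝ (fderiv ℝ ψ) z (hvec (EuclideanSpace.single i 1) z)
        (hvec (EuclideanSpace.single j 1) z) := by
  have hsymm := hψ.isSymmSndFDerivAt (by simp)
  rw [horHess, Matrix.of_apply, X_X_eq hψ, X_X_eq hψ, hsymm.eq (hvec (EuclideanSpace.single j 1) z),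
    inner_Jvec_left (EuclideanSpace.single j (1 : ℝ))]
  have : ((0, 2 * -inner ℝ (Jvec (EuclideanSpace.single i (1 : ℝ)))
      (EuclideanSpace.single j (1 : ℝ))) : Hn n)
      = -(0, 2 * inner ℝ (Jvec (EuclideanSpace.single i (1 : ℝ))) (EuclideanSpace.single j (1 : ℝ)))
      := by ext1 <;> simp
  rw [this, map_neg]
  ring

/-- The `l`-th row of a matrix, as a vector. -/
def row (B : Mat n) (l : Fin n ⊕ Fin n) : EuclideanSpace ℝ (Fin n ⊕ Fin n) := WithLp.toLp 2 (B l)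

lemma trace_mul_horHess {ψ : Hn n → ℝ} {z : Hn n} (hψ : ContDiffAt ℝ 2 ψ z) (B : Mat n) :
    Matrix.trace (Bᵀ * B * horHess ψ z)
      = ∑ l, fderiv ℝ (fderiv ℝ ψ) z (hvec (row B l) z) (hvec (row B l) z) := by
  have h : ∀ l, fderiv ℝ (fderiv ℝ ψ) z (hvec (row B l) z) (hvec (row B l) z)
      = ∑ i, ∑ j, B l i * B l j * horHess ψ z i j := by
    intro l
    conv_lhs => rw [hvec_eq_sum (row B l) z]
    simp only [map_sum, map_smul, sum_apply, smul_apply,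
      smul_eq_mul, horHess_apply hψ, row, Finset.mul_sum]
    rw [Finset.sum_comm]
    refine Finset.sum_congr rfl fun i _ => Finset.sum_congr rfl fun j _ => by ring
  have hs : ∀ i j, horHess ψ z i j = horHess ψ z j i := by
    intro i j; simp only [horHess, Matrix.of_apply]; ring
  simp only [h, Matrix.trace, Matrix.diag, Matrix.mul_apply, Matrix.transpose_apply,
    Finset.sum_mul]
  rw [Finset.sum_comm_cycle]
  refine Finset.sum_congr rfl fun l _ => Finset.sum_congr rfl fun i _ =>
    Finset.sum_congr rfl fun j _ => ?_
  rw [hs i j]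

/-- The symmetric second difference along the rows of `B`, with respect to the group law. -/
def secDiff (B : Mat n) (ψ : Hn n → ℝ) (z : Hn n) (s : ℝ) : ℝ :=
  ∑ l, (ψ (gmul z (s • row B l, 0)) + ψ (gmul z ((-s) • row B l, 0)) - 2 * ψ z)

/-- Uniformity in the base point near `w` is what later allows a compactness argument over all
translates of the kernel by points of `S`. -/
lemma eventually_secDiff_le {ψ : Hn n → ℝ} {w : Hn n} (hψ : ContDiffAt ℝ 2 ψ w) (B : Mat n)
    (h : Matrix.trace (Bᵀ * B * horHess ψ w) ≤ 0) {η : ℝ} (hη : 0 < η) :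
    ∀ᶠ p : ℝ × Hn n in 𝓝 (0, w), secDiff B ψ p.2 p.1 ≤ η * p.1 ^ 2 := by
  rw [trace_mul_horHess hψ] at h
  set D := fderiv ℝ (fderiv ℝ ψ) w
  have hcv : ∀ l, Continuous (fun z : Hn n => hvec (row B l) z) := fun l => by
    unfold hvec; fun_prop
  set C : ℝ := ∑ l, ‖hvec (row B l) w‖ ^ 2 with hC
  have hC0 : 0 ≤ C := by positivity
  -- The Taylor error then uses at most half of `η` at `w`; the other half leaves room to move the
  -- base point by continuity.
  set κ := η / (2 * (C + 1)) with hκ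
  have hκ0 : 0 < κ := by positivity
  have e1 : ∀ l, ∀ᶠ p : ℝ × Hn n in 𝓝 (0, w),
      |ψ (p.2 + p.1 • hvec (row B l) p.2) + ψ (p.2 - p.1 • hvec (row B l) p.2) - 2 * ψ p.2
        - D (p.1 • hvec (row B l) p.2) (p.1 • hvec (row B l) p.2)|
        ≤ κ * ‖p.1 • hvec (row B l) p.2‖ ^ 2 := by
    intro l
    have ht : Tendsto (fun p : ℝ × Hn n => (p.2, p.1 • hvec (row B l) p.2)) (𝓝 (0, w))
        (𝓝 (w, 0)) := by
      have : Continuous (fun p : ℝ × Hn n => (p.2, p.1 • hvec (row B l) p.2)) := by fun_prop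
      simpa using this.tendsto (0, w)
    exact ht.eventually (eventually_secondDifference hψ hκ0)
  have e2 : ∀ᶠ p : ℝ × Hn n in 𝓝 (0, w),
      ∑ l, (D (hvec (row B l) p.2) (hvec (row B l) p.2) + κ * ‖hvec (row B l) p.2‖ ^ 2) < η := by
    have hcont : Continuous (fun p : ℝ × Hn n =>
      ∑ l, (D (hvec (row B l) p.2) (hvec (row B l) p.2) + κ * ‖hvec (row B l) p.2‖ ^ 2)) := by
      fun_prop
    refine (hcont.tendsto (0, w)).eventually_lt_const ?_
    simp only [Finset.sum_add_distrib, ← Finset.mul_sum]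
    rw [← hC]
    have : κ * C ≤ η / 2 := by
      rw [hκ, div_mul_eq_mul_div, div_le_iff₀ (by positivity)]
      nlinarith
    linarith
  filter_upwards [e2, eventually_all.2 e1] with p hp2 hp1
  calc secDiff B ψ p.2 p.1
      ≤ ∑ l, p.1 ^ 2 * (D (hvec (row B l) p.2) (hvec (row B l) p.2)
          + κ * ‖hvec (row B l) p.2‖ ^ 2) := by
        refine Finset.sum_le_sum fun l _ => ?_
        have := (abs_le.1 (hp1 l)).2
        rw [gmul_smul_line, gmul_smul_line, neg_smul, ← sub_eq_add_neg]
        simp only [map_smul, smul_apply, smul_eq_mul, norm_smul, mul_pow,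
          Real.norm_eq_abs, sq_abs] at this
        change ψ (p.2 + p.1 • hvec (row B l) p.2) + ψ (p.2 - p.1 • hvec (row B l) p.2) - 2 * ψ p.2
          ≤ _
        linarith
    _ = p.1 ^ 2 * ∑ l, (D (hvec (row B l) p.2) (hvec (row B l) p.2)
          + κ * ‖hvec (row B l) p.2‖ ^ 2) := by rw [Finset.mul_sum]
    _ ≤ p.1 ^ 2 * η := by gcongr
    _ = _ := mul_comm _ _

open scoped MatrixOrder in
lemma exists_transpose_mul_self {A : Mat n} (hA : A.PosSemidef) : ∃ B : Mat n, A = Bᵀ * B := by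
  have h := CFC.sqrt_mul_sqrt_self A hA.nonneg
  have h2 : (CFC.sqrt A).PosSemidef := Matrix.nonneg_iff_posSemidef.1 (CFC.sqrt_nonneg A)
  refine ⟨CFC.sqrt A, ?_⟩
  have h3 : (CFC.sqrt A)ᵀ = CFC.sqrt A := by
    have := h2.isHermitian.eq
    rwa [Matrix.conjTranspose_eq_transpose_of_trivial] at this
  rw [h3, h]

/-- The exact second difference of the squared horizontal distance to a point. -/
lemma secDiff_norm_sq (B : Mat n) (x₀ : EuclideanSpace ℝ (Fin n ⊕ Fin n)) (z : Hn n) (s : ℝ) :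
    secDiff B (fun w => ‖w.1 - x₀‖ ^ 2) z s = 2 * s ^ 2 * ∑ l, ‖row B l‖ ^ 2 := by
  rw [secDiff, Finset.mul_sum]
  refine Finset.sum_congr rfl fun l _ => ?_
  simp only [gmul, add_sub_right_comm z.1 _ x₀, norm_add_sq_real, norm_smul, inner_smul_right,
    mul_pow, Real.norm_eq_abs, sq_abs]
  ring

lemma sum_norm_row_sq (B : Mat n) : ∑ l, ‖row B l‖ ^ 2 = Matrix.trace (Bᵀ * B) := by
  simp only [Matrix.trace, Matrix.diag, Matrix.mul_apply, Matrix.transpose_apply,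
    EuclideanSpace.norm_sq_eq, row, Real.norm_eq_abs, sq_abs]
  rw [Finset.sum_comm]
  refine Finset.sum_congr rfl fun i _ => Finset.sum_congr rfl fun j _ => by ring

lemma secDiff_sub (B : Mat n) (ψ χ : Hn n → ℝ) (z : Hn n) (s : ℝ) :
    secDiff B (fun w => ψ w - χ w) z s = secDiff B ψ z s - secDiff B χ z s := by
  rw [secDiff, secDiff, secDiff, ← Finset.sum_sub_distrib]
  exact Finset.sum_congr rfl fun l _ => by ring

lemma secDiff_const_mul (B : Mat n) (c : ℝ) (ψ : Hn n → ℝ) (z : Hn n) (s : ℝ) :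
    secDiff B (fun w => c * ψ w) z s = c * secDiff B ψ z s := by
  rw [secDiff, secDiff, Finset.mul_sum]
  exact Finset.sum_congr rfl fun l _ => by ring

lemma eventually_secDiff_nonneg {v : Hn n → ℝ} {z : Hn n} (h : IsLocalMin v z) (B : Mat n) :
    ∀ᶠ s : ℝ in 𝓝 0, 0 ≤ secDiff B v z s := by
  have ht : ∀ l, ∀ c : ℝ, ∀ᶠ s : ℝ in 𝓝 0, v z ≤ v (gmul z ((c * s) • row B l, 0)) := by
    intro l c
    have hc : Continuous fun s : ℝ => gmul z ((c * s) • row B l, (0 : ℝ)) := by fun_prop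
    have : Tendsto (fun s : ℝ => gmul z ((c * s) • row B l, (0 : ℝ))) (𝓝 0) (𝓝 z) := by
      have := hc.tendsto 0
      simpa [gmul_zero, ← Prod.zero_eq_mk] using this
    exact this.eventually h
  filter_upwards [eventually_all.2 fun l => ht l 1, eventually_all.2 fun l => ht l (-1)]
    with s h1 h2
  refine Finset.sum_nonneg fun l _ => ?_
  have a := h1 l
  have b := h2 l
  simp only [one_mul, neg_one_mul] at a b
  linarith

/-- `h` is a subsolution at `z`, in the sense of symmetric second differences. -/
def IsSubAt (B : Mat n) (h : Hn n → ℝ) (z : Hn n) : Prop :=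
  ∀ η : ℝ, 0 < η → ∀ᶠ s : ℝ in 𝓝 0, -(η * s ^ 2) ≤ secDiff B h z s

/-- At a minimum second differences are nonnegative, while the quadratic penalty contributes exactly
`-2γτs²`. The errors from `u` and `h`, at most `γτs²/2` each, cannot compensate. -/
lemma not_isLocalMin_sub {u h : Hn n → ℝ} {z : Hn n} {x₀ : EuclideanSpace ℝ (Fin n ⊕ Fin n)}
    {B : Mat n} (htr : 0 < Matrix.trace (Bᵀ * B)) (hu : ContDiffAt ℝ 2 u z)
    (hLu : Matrix.trace (Bᵀ * B * horHess u z) ≤ 0) (hh : IsSubAt B h z) {γ : ℝ} (hγ : 0 < γ) :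
    ¬ IsLocalMin (fun w => u w - h w - γ * ‖w.1 - x₀‖ ^ 2) z := by
  intro hmin
  set τ := Matrix.trace (Bᵀ * B)
  have hη : 0 < γ * τ / 2 := by positivity
  have e1 := eventually_secDiff_nonneg hmin B
  have e2 : ∀ᶠ s : ℝ in 𝓝 0, secDiff B u z s ≤ γ * τ / 2 * s ^ 2 := by
    have hc : Continuous fun s : ℝ => (s, z) := by fun_prop
    have := (hc.tendsto 0).eventually (eventually_secDiff_le hu B hLu hη)
    exact this
  have e3 := hh _ hη
  obtain ⟨s, ⟨h1, h2, h3⟩, hs⟩ :=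
    (((e1.and (e2.and e3)).filter_mono nhdsWithin_le_nhds).and
      (self_mem_nhdsWithin : Ioi (0 : ℝ) ∈ 𝓝[>] 0)).exists
  rw [secDiff_sub B (fun w => u w - h w), secDiff_sub, secDiff_const_mul, secDiff_norm_sq,
    sum_norm_row_sq] at h1
  have hs' : 0 < s := hs
  have : 0 < γ * τ * s ^ 2 := by positivity
  linarith

/-! ### Gauges, integrals of their kernels, and extremal potentials -/

/-- Exchanging `S \ G` for `G \ S` does not decrease the integral: the latter has at least the
measure, and `f` is at least `c` there against at most `c` on the former. The lower bound is only
almost everywhere because real powers give the kernel the value `0` at the origin. -/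
lemma lintegral_bathtub {α : Type*} [MeasurableSpace α] {μ : Measure α} {f : α → ℝ≥0∞} {c : ℝ≥0∞}
    {G S : Set α} (hG : MeasurableSet G) (hS : MeasurableSet S) (hfin : μ G ≠ ∞)
    (hSG : μ S ≤ μ G) (h1 : ∀ x ∉ G, f x ≤ c) (h2 : ∀ᵐ x ∂μ, x ∈ G → c ≤ f x) :
    ∫⁻ x in S, f x ∂μ ≤ ∫⁻ x in G, f x ∂μ := by
  have hdiff : μ (S \ G) ≤ μ (G \ S) := by
    have e1 := measure_inter_add_sdiff (μ := μ) S hG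
    have e2 := measure_inter_add_sdiff (μ := μ) G hS
    rw [← e1, ← e2, inter_comm G S] at hSG
    exact (ENNReal.add_le_add_iff_left (measure_ne_top_of_subset inter_subset_right hfin)).1 hSG
  rw [← lintegral_inter_add_sdiff f S hG, ← lintegral_inter_add_sdiff f G hS, inter_comm G S]
  refine add_le_add le_rfl ?_
  calc ∫⁻ x in S \ G, f x ∂μ ≤ ∫⁻ _ in S \ G, c ∂μ :=
        setLIntegral_mono measurable_const fun x hx => h1 x hx.2
    _ = c * μ (S \ G) := setLIntegral_const _ _
    _ ≤ c * μ (G \ S) := by gcongr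
    _ = ∫⁻ _ in G \ S, c ∂μ := (setLIntegral_const _ _).symm
    _ ≤ ∫⁻ x in G \ S, f x ∂μ :=
        setLIntegral_mono_ae' (hG.diff hS) (h2.mono fun x hx hxG => hx hxG.1)

/-- A continuous, even function, homogeneous of degree four with respect to the dilations, and
comparable to `rho ^ 4`. -/
structure IsGauge (a b : ℝ) (φ : Hn n → ℝ) : Prop where
  cont : Continuous φ
  dil : ∀ R z, φ (dil n R z) = R ^ 4 * φ z
  even : ∀ z, φ (ginv z) = φ z
  pos : 0 < a
  lower : ∀ z, a * rho z ^ 4 ≤ φ z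
  upper : ∀ z, φ z ≤ b * rho z ^ 4

namespace IsGauge

variable {a b : ℝ} {φ : Hn n → ℝ}

lemma nonneg (h : IsGauge a b φ) (z : Hn n) : 0 ≤ φ z :=
  (mul_nonneg h.pos.le (pow_nonneg (rho_nonneg z) 4)).trans (h.lower z)

lemma pos_of_ne (h : IsGauge a b φ) {z : Hn n} (hz : z ≠ 0) : 0 < φ z :=
  (mul_pos h.pos (pow_pos (rho_pos hz) 4)).trans_le (h.lower z)

lemma rho_le (h : IsGauge a b φ) {z : Hn n} {s : ℝ} (hs : 0 ≤ s) (hz : φ z ≤ a * s ^ 4) :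
    rho z ≤ s := by
  have := (h.lower z).trans hz
  exact (pow_le_pow_iff_left₀ (rho_nonneg z) hs (by norm_num)).1 (le_of_mul_le_mul_left this h.pos)

lemma isCompact_le (h : IsGauge a b φ) (θ : ℝ) : IsCompact {z | φ z ≤ θ} := by
  refine (isCompact_rho_le (max 1 (θ / a))).of_isClosed_subset
    (isClosed_le h.cont continuous_const) fun z hz => ?_
  have hz' : φ z ≤ θ := hz
  refine h.rho_le (by positivity) (hz'.trans ?_)
  have h1 : θ / a ≤ max 1 (θ / a) := le_max_right _ _
  have h2 : (1 : ℝ) ≤ max 1 (θ / a) := le_max_left _ _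
  rw [div_le_iff₀ h.pos] at h1
  have h3 : max 1 (θ / a) ≤ max 1 (θ / a) ^ 4 := le_self_pow₀ h2 (by norm_num)
  nlinarith [h.pos]

lemma measurableSet_le (h : IsGauge a b φ) (θ : ℝ) : MeasurableSet {z | φ z ≤ θ} :=
  (isClosed_le h.cont continuous_const).measurableSet

/-- Dilation by `θ^{1/4}` scales volume by `θ^{Q/4}`, and `Q/4 = (n+1)/2`. -/
lemma volume_le_eq (h : IsGauge a b φ) {θ : ℝ} (hθ : 0 < θ) :
    volume {z | φ z ≤ θ} = ENNReal.ofReal (θ ^ (((n : ℝ) + 1) / 2)) * volume {z | φ z ≤ 1} := by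
  set R : ℝ := θ ^ (1 / 4 : ℝ) with hR
  have hR0 : 0 < R := Real.rpow_pos_of_pos hθ _
  have hR4 : R ^ 4 = θ := by
    rw [hR, ← Real.rpow_natCast, ← Real.rpow_mul hθ.le]; norm_num
  have hRn : R ^ (2 * n + 2) = θ ^ (((n : ℝ) + 1) / 2) := by
    rw [hR, ← Real.rpow_natCast, ← Real.rpow_mul hθ.le]
    congr 1; push_cast; ring
  have himg : {z | φ z ≤ θ} = Heisenberg.dil n R '' {z | φ z ≤ 1} := by
    ext z
    constructor
    · intro hz
      refine ⟨Heisenberg.dil n R⁻¹ z, ?_, ?_⟩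
      · rw [mem_ofPred_eq, h.dil, inv_pow, hR4, inv_mul_le_iff₀ hθ, mul_one]; exact hz
      · ext1 <;> simp [dil_apply, hR0.ne']
    · rintro ⟨w, hw, rfl⟩
      rw [mem_ofPred_eq, h.dil, hR4]
      exact mul_le_of_le_one_right hθ.le hw
  rw [himg, volume_dil_image R hR0.le, hRn]

lemma volume_one_ne_top (h : IsGauge a b φ) : volume {z | φ z ≤ 1} ≠ ∞ :=
  (h.isCompact_le 1).measure_ne_top

lemma map_zero (h : IsGauge a b φ) : φ 0 = 0 := by
  refine le_antisymm ?_ (h.nonneg 0)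
  simpa [rho_zero] using h.upper 0

lemma volume_one_ne_zero (h : IsGauge a b φ) : volume {z | φ z ≤ 1} ≠ 0 := by
  have ho : IsOpen {z | φ z < 1} := isOpen_lt h.cont continuous_const
  have hne : {z | φ z < 1}.Nonempty := ⟨0, by simp [h.map_zero]⟩
  have := ho.measure_pos volume hne
  exact (this.trans_le (measure_mono fun z (hz : φ z < 1) => hz.le)).ne'

/-- The kernel `φ ^ (-α)` with values in `[0, ∞]`. -/
def ker (φ : Hn n → ℝ) (α : ℝ) (w : Hn n) : ℝ≥0∞ := ENNReal.ofReal (φ w ^ (-α))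

lemma measurable_ker (h : IsGauge a b φ) (α : ℝ) : Measurable (ker φ α) :=
  (h.cont.measurable.pow_const _).ennreal_ofReal

/-- The geometric constant in the bound for the integral of the kernel. -/
def shellConst (n : ℕ) (α : ℝ) : ℝ := 2 ^ α / (1 - 2 ^ (-(((n : ℝ) + 1) / 2 - α)))

lemma shellConst_pos {α : ℝ} (hα : α < ((n : ℝ) + 1) / 2) : 0 < shellConst n α := by
  unfold shellConst
  have : (2 : ℝ) ^ (-(((n : ℝ) + 1) / 2 - α)) < 1 :=
    Real.rpow_lt_one_of_one_lt_of_neg (by norm_num) (by linarith)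
  have h2 : (0 : ℝ) < 2 ^ α := by positivity
  exact div_pos h2 (by linarith)

/-- Sum over dyadic shells of `φ`: the kernel is nearly constant on each, and the contributions
decay geometrically with ratio `2^{-(Q/4-α)}`, which is less than `1` exactly when `α < Q/4`. -/
lemma lintegral_ker_le (h : IsGauge a b φ) {α : ℝ} (hα0 : 0 < α) (hα : α < ((n : ℝ) + 1) / 2)
    {θ : ℝ} (hθ : 0 < θ) :
    ∫⁻ w in {z | φ z ≤ θ}, ker φ α w
      ≤ ENNReal.ofReal (shellConst n α * θ ^ (((n : ℝ) + 1) / 2 - α)) * volume {z | φ z ≤ 1} := by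
  set β := ((n : ℝ) + 1) / 2 with hβ
  set q : ℝ := 2 ^ (-(β - α)) with hq
  have hq0 : 0 < q := by positivity
  have hq1 : q < 1 := Real.rpow_lt_one_of_one_lt_of_neg (by norm_num) (by linarith)
  set c := volume {z | φ z ≤ 1}
  set s : ℕ → Set (Hn n) := fun j => {z | (1 / 2 : ℝ) ^ (j + 1) * θ < φ z ∧ φ z ≤ (1 / 2) ^ j * θ}
  have hsub : {z | φ z ≤ θ} ⊆ {0} ∪ ⋃ j, s j := by
    intro z hz
    by_cases h0 : z = 0
    · exact Or.inl h0
    · right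
      have hp := h.pos_of_ne h0
      obtain ⟨j, hj1, hj2⟩ := exists_nat_pow_near_of_lt_one (x := φ z / θ) (y := (1 / 2 : ℝ))
        (by positivity) ((div_le_one hθ).2 hz) (by norm_num) (by norm_num)
      rw [lt_div_iff₀ hθ] at hj1
      rw [div_le_iff₀ hθ] at hj2
      exact mem_iUnion.2 ⟨j, hj1, hj2⟩
  have hshell : ∀ j, ∫⁻ w in s j, ker φ α w
      ≤ ENNReal.ofReal (2 ^ α * θ ^ (β - α)) * c * ENNReal.ofReal q ^ j := by
    intro j
    have hj : (0 : ℝ) < (1 / 2) ^ j * θ := by positivity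
    have hj1 : (0 : ℝ) < (1 / 2) ^ (j + 1) * θ := by positivity
    calc ∫⁻ w in s j, ker φ α w
        ≤ ∫⁻ _ in s j, ENNReal.ofReal (((1 / 2 : ℝ) ^ (j + 1) * θ) ^ (-α)) := by
          refine setLIntegral_mono measurable_const fun w hw => ENNReal.ofReal_le_ofReal ?_
          exact Real.rpow_le_rpow_of_nonpos hj1 hw.1.le (by linarith)
      _ = ENNReal.ofReal (((1 / 2 : ℝ) ^ (j + 1) * θ) ^ (-α)) * volume (s j) :=
          setLIntegral_const _ _
      _ ≤ ENNReal.ofReal (((1 / 2 : ℝ) ^ (j + 1) * θ) ^ (-α))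
            * volume {z | φ z ≤ (1 / 2) ^ j * θ} := by
          gcongr; exact fun z hz => hz.2
      _ = ENNReal.ofReal (((1 / 2 : ℝ) ^ (j + 1) * θ) ^ (-α) * ((1 / 2 : ℝ) ^ j * θ) ^ β) * c := by
          rw [h.volume_le_eq hj, ← mul_assoc, ← ENNReal.ofReal_mul (by positivity)]
      _ = ENNReal.ofReal (2 ^ α * θ ^ (β - α) * q ^ j) * c := by
          congr 2
          have e1 : ((1 / 2 : ℝ) ^ (j + 1) * θ) ^ (-α) = 2 ^ α * ((1 / 2 : ℝ) ^ j * θ) ^ (-α) := by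
            rw [show (1 / 2 : ℝ) ^ (j + 1) * θ = (1 / 2) * ((1 / 2 : ℝ) ^ j * θ) by ring,
              Real.mul_rpow (by norm_num) hj.le, Real.rpow_neg (by norm_num),
              ← Real.inv_rpow (by norm_num)]
            norm_num
          rw [e1, mul_assoc, ← Real.rpow_add hj, neg_add_eq_sub,
            Real.mul_rpow (by positivity) hθ.le, hq, ← Real.rpow_natCast (2 ^ (-(β - α))),
            ← Real.rpow_mul (by norm_num), ← Real.rpow_natCast (1 / 2 : ℝ), ← Real.rpow_mul
            (by norm_num), one_div, Real.inv_rpow (by norm_num), ← Real.rpow_neg (by norm_num)]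
          ring_nf
      _ = _ := by
          rw [ENNReal.ofReal_mul (by positivity), ENNReal.ofReal_pow hq0.le]; ring
  calc ∫⁻ w in {z | φ z ≤ θ}, ker φ α w
      ≤ ∫⁻ w in {0} ∪ ⋃ j, s j, ker φ α w := lintegral_mono_set hsub
    _ ≤ (∫⁻ w in {0}, ker φ α w) + ∫⁻ w in ⋃ j, s j, ker φ α w := lintegral_union_le _ _ _
    _ = ∫⁻ w in ⋃ j, s j, ker φ α w := by
        rw [setLIntegral_measure_zero _ _ (measure_singleton 0), zero_add]
    _ ≤ ∑' j, ∫⁻ w in s j, ker φ α w := lintegral_iUnion_le _ _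
    _ ≤ ∑' j, ENNReal.ofReal (2 ^ α * θ ^ (β - α)) * c * ENNReal.ofReal q ^ j :=
        ENNReal.tsum_le_tsum hshell
    _ = ENNReal.ofReal (2 ^ α * θ ^ (β - α)) * c * (1 - ENNReal.ofReal q)⁻¹ := by
        rw [ENNReal.tsum_mul_left, ENNReal.tsum_geometric]
    _ = _ := by
        have : (1 - ENNReal.ofReal q)⁻¹ = ENNReal.ofReal ((1 - q)⁻¹) := by
          rw [ENNReal.ofReal_inv_of_pos (by linarith), ENNReal.ofReal_sub _ hq0.le,
            ENNReal.ofReal_one]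
        rw [this, mul_right_comm, ← ENNReal.ofReal_mul (by positivity), shellConst, ← hβ, ← hq]
        congr 2; ring

lemma le_lintegral_ker (h : IsGauge a b φ) {α : ℝ} (hα0 : 0 < α) {θ : ℝ} (hθ : 0 < θ) :
    ENNReal.ofReal (θ ^ (((n : ℝ) + 1) / 2 - α)) * volume {z | φ z ≤ 1}
      ≤ ∫⁻ w in {z | φ z ≤ θ}, ker φ α w := by
  calc ENNReal.ofReal (θ ^ (((n : ℝ) + 1) / 2 - α)) * volume {z | φ z ≤ 1}
      = ENNReal.ofReal (θ ^ (-α)) * volume {z | φ z ≤ θ} := by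
        rw [h.volume_le_eq hθ, ← mul_assoc, ← ENNReal.ofReal_mul (by positivity),
          ← Real.rpow_add hθ]
        ring_nf
    _ = ∫⁻ _ in {z | φ z ≤ θ}, ENNReal.ofReal (θ ^ (-α)) := (setLIntegral_const _ _).symm
    _ ≤ _ := by
        refine setLIntegral_mono_ae' (h.measurableSet_le θ) ?_
        have h0 : ∀ᵐ x : Hn n, x ≠ 0 := by
          rw [ae_iff]; simp
        filter_upwards [h0] with x hx hxθ
        exact ENNReal.ofReal_le_ofReal
          (Real.rpow_le_rpow_of_nonpos (h.pos_of_ne hx) hxθ (by linarith))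

/-- The potential of the set `S`. -/
def pot (φ : Hn n → ℝ) (α : ℝ) (S : Set (Hn n)) (z : Hn n) : ℝ≥0∞ :=
  ∫⁻ ζ in S, ker φ α (gmul (ginv ζ) z)

/-- The change of variable `w = ζ⁻¹ ∘ z` preserves measure, so every potential is an integral of one
fixed kernel over a reflected set of the same volume. -/
lemma pot_eq (h : IsGauge a b φ) (α : ℝ) {S : Set (Hn n)} (hS : MeasurableSet S) (z : Hn n) :
    pot φ α S z = ∫⁻ w in {w | gmul z (ginv w) ∈ S}, ker φ α w := by
  have hm : MeasurableSet {w | gmul z (ginv w) ∈ S} :=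
    (show Continuous fun w => gmul z (ginv w) by fun_prop).measurable hS
  have := (measurePreserving_ginv_gmul z).setLIntegral_comp_preimage hm (h.measurable_ker α)
  rw [← this, pot]
  congr 2
  ext ζ
  simp [ginv_gmul_rev, ginv_ginv, gmul_ginv_cancel_left]

lemma volume_reflect {S : Set (Hn n)} (hS : MeasurableSet S) (z : Hn n) :
    volume {w | gmul z (ginv w) ∈ S} = volume S := by
  have := ((measurePreserving_gmul z).comp measurePreserving_ginv).measure_preimage
    hS.nullMeasurableSet
  exact this

lemma measurableSet_reflect {S : Set (Hn n)} (hS : MeasurableSet S) (z : Hn n) :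
    MeasurableSet {w | gmul z (ginv w) ∈ S} :=
  (show Continuous fun w => gmul z (ginv w) by fun_prop).measurable hS

lemma pot_le (h : IsGauge a b φ) {α : ℝ} (hα0 : 0 < α) {θ : ℝ} (hθ : 0 < θ) {S : Set (Hn n)}
    (hS : MeasurableSet S) (hvol : volume S ≤ volume {z | φ z ≤ θ}) (z : Hn n) :
    pot φ α S z ≤ ∫⁻ w in {z | φ z ≤ θ}, ker φ α w := by
  rw [h.pot_eq α hS]
  refine lintegral_bathtub (c := ENNReal.ofReal (θ ^ (-α))) (h.measurableSet_le θ)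
    (measurableSet_reflect hS z) (h.isCompact_le θ).measure_ne_top
    (by rwa [volume_reflect hS]) ?_ ?_
  · intro x hx
    rw [mem_ofPred_eq, not_le] at hx
    exact ENNReal.ofReal_le_ofReal (Real.rpow_le_rpow_of_nonpos hθ hx.le (by linarith))
  · have h0 : ∀ᵐ x : Hn n, x ≠ 0 := by
      rw [ae_iff]; simp
    filter_upwards [h0] with x hx hxθ
    exact ENNReal.ofReal_le_ofReal
      (Real.rpow_le_rpow_of_nonpos (h.pos_of_ne hx) hxθ (by linarith))

/-- Splits at a free level `θ`: the kernel is bounded outside the gauge ball and integrable inside.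
It serves to show that removing a set of small measure costs little. -/
lemma pot_le_add (h : IsGauge a b φ) {α : ℝ} (hα0 : 0 < α) {θ : ℝ} (hθ : 0 < θ) {S : Set (Hn n)}
    (hS : MeasurableSet S) (z : Hn n) :
    pot φ α S z ≤ ENNReal.ofReal (θ ^ (-α)) * volume S + ∫⁻ w in {z | φ z ≤ θ}, ker φ α w := by
  rw [h.pot_eq α hS, ← volume_reflect hS z,
    ← lintegral_inter_add_sdiff (ker φ α) _ (h.measurableSet_le θ), add_comm]
  gcongr ?_ + ?_
  · calc _ ≤ ∫⁻ _ in {w | gmul z (ginv w) ∈ S} \ {z | φ z ≤ θ}, ENNReal.ofReal (θ ^ (-α)) := by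
          refine setLIntegral_mono measurable_const fun x hx => ?_
          have hx2 : θ < φ x := not_le.1 hx.2
          exact ENNReal.ofReal_le_ofReal (Real.rpow_le_rpow_of_nonpos hθ hx2.le (by linarith))
      _ = ENNReal.ofReal (θ ^ (-α)) * volume ({w | gmul z (ginv w) ∈ S} \ {z | φ z ≤ θ}) :=
          setLIntegral_const _ _
      _ ≤ _ := by gcongr; exact sdiff_subset
  · exact lintegral_mono_set inter_subset_right

lemma pot_le_of_far {φ : Hn n → ℝ} {α : ℝ} (hα0 : 0 < α) {T : ℝ} (hT : 0 < T) {S : Set (Hn n)}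
    (hS : MeasurableSet S) {z : Hn n} (hfar : ∀ ζ ∈ S, T ≤ φ (gmul (ginv ζ) z)) :
    pot φ α S z ≤ ENNReal.ofReal (T ^ (-α)) * volume S := by
  calc _ ≤ ∫⁻ _ in S, ENNReal.ofReal (T ^ (-α)) :=
        setLIntegral_mono' hS fun ζ hζ => ENNReal.ofReal_le_ofReal
          (Real.rpow_le_rpow_of_nonpos hT (hfar ζ hζ) (by linarith))
    _ = _ := setLIntegral_const _ _

/-- The closed gauge ball centred at `z`. -/
def gball (φ : Hn n → ℝ) (z : Hn n) (θ : ℝ) : Set (Hn n) := {ζ | φ (gmul (ginv ζ) z) ≤ θ}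

lemma isClosed_gball (h : IsGauge a b φ) (z : Hn n) (θ : ℝ) : IsClosed (gball φ z θ) :=
  isClosed_le (h.cont.comp (by fun_prop)) continuous_const

lemma gball_reflect (z : Hn n) (θ : ℝ) : {w | gmul z (ginv w) ∈ gball φ z θ} = {w | φ w ≤ θ} := by
  ext w
  simp only [gball, mem_ofPred_eq, ginv_gmul_rev, ginv_ginv, gmul_assoc, ginv_gmul, gmul_zero]

lemma pot_gball (h : IsGauge a b φ) (α : ℝ) (z : Hn n) (θ : ℝ) :
    pot φ α (gball φ z θ) z = ∫⁻ w in {w | φ w ≤ θ}, ker φ α w := by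
  rw [h.pot_eq α (h.isClosed_gball z θ).measurableSet, gball_reflect]

lemma volume_gball (h : IsGauge a b φ) (z : Hn n) (θ : ℝ) :
    volume (gball φ z θ) = volume {w | φ w ≤ θ} := by
  rw [← volume_reflect (h.isClosed_gball z θ).measurableSet z, gball_reflect]

lemma gball_subset (h : IsGauge a b φ) {z : Hn n} {s : ℝ} (hs : 0 ≤ s) :
    gball φ z (a * s ^ 4) ⊆ {ζ | kdist ζ z ≤ s} := fun _ hζ => h.rho_le hs hζ

lemma volume_kball_le (h : IsGauge a b φ) (z : Hn n) {r : ℝ} (hr : 0 < r) :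
    volume (kball z r) ≤ ENNReal.ofReal ((b * r ^ 4) ^ (((n : ℝ) + 1) / 2))
      * volume {z | φ z ≤ 1} := by
  -- Positivity of `b` follows by comparing both gauge bounds at the point `(0, 1)`.
  have hb : 0 < b := by
    have h1 : (0 : Hn n) ≠ (0, 1) := by
      intro h; simpa using congrArg Prod.snd h
    have h2 := (mul_pos h.pos (pow_pos (rho_pos h1.symm) 4)).trans_le
      ((h.lower _).trans (h.upper _))
    exact pos_of_mul_pos_left h2 (by positivity)
  rw [← h.volume_le_eq (by positivity)]
  have heq : kball z r = gmul (ginv z) ⁻¹' {w | rho w < r} := rfl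
  rw [heq, (measurePreserving_gmul (ginv z)).measure_preimage
    (isOpen_lt continuous_rho continuous_const).measurableSet.nullMeasurableSet]
  refine measure_mono fun w hw => (h.upper w).trans ?_
  have hw' : rho w < r := hw
  have := rho_nonneg w
  gcongr

end IsGauge

/-! ### Real-valued potentials and the comparison principle -/

section

/-- The potential of the set `S` with respect to a real-valued kernel. -/
def rpot (k : Hn n → ℝ) (S : Set (Hn n)) (z : Hn n) : ℝ := ∫ ζ in S, k (gmul (ginv ζ) z)

variable {k : Hn n → ℝ} {S : Set (Hn n)}

lemma gmul_ginv_ne_zero {z ζ : Hn n} (hz : z ∉ S) (hζ : ζ ∈ S) : gmul (ginv ζ) z ≠ 0 :=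
  fun h => hz (ginv_gmul_eq_zero h ▸ hζ)

lemma integrableOn_kernel (hk : ContinuousOn k {0}ᶜ) (hS : IsCompact S) {z : Hn n} (hz : z ∉ S) :
    IntegrableOn (fun ζ => k (gmul (ginv ζ) z)) S :=
  (hk.comp (show Continuous fun ζ : Hn n => gmul (ginv ζ) z by fun_prop).continuousOn
    fun _ hζ => gmul_ginv_ne_zero hz hζ).integrableOn_compact hS

lemma continuousAt_rpot (hk : ContinuousOn k {0}ᶜ) (hS : IsCompact S) {z : Hn n} (hz : z ∉ S) :
    ContinuousAt (rpot k S) z := by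
  set v := volume.real S
  have hv : 0 ≤ v := measureReal_nonneg
  rw [Metric.continuousAt_iff']
  intro ε hε
  have key : ∀ᶠ z' in 𝓝 z, ∀ ζ ∈ S,
      |k (gmul (ginv ζ) z') - k (gmul (ginv ζ) z)| ≤ ε / (2 * (v + 1)) := by
    refine hS.eventually_forall_of_forall_eventually fun ζ hζ => ?_
    have hne := gmul_ginv_ne_zero hz hζ
    have hkc : ContinuousAt k (gmul (ginv ζ) z) :=
      hk.continuousAt (isOpen_compl_singleton.mem_nhds hne)
    have c1 : ContinuousAt (fun p : Hn n × Hn n => k (gmul (ginv p.2) p.1)) (z, ζ) :=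
      ContinuousAt.comp (f := fun p : Hn n × Hn n => gmul (ginv p.2) p.1) (g := k) hkc
        (show Continuous fun p : Hn n × Hn n => gmul (ginv p.2) p.1 by fun_prop).continuousAt
    have c2 : ContinuousAt (fun p : Hn n × Hn n => k (gmul (ginv p.2) z)) (z, ζ) :=
      ContinuousAt.comp (f := fun p : Hn n × Hn n => gmul (ginv p.2) z) (g := k) hkc
        (show Continuous fun p : Hn n × Hn n => gmul (ginv p.2) z by fun_prop).continuousAt
    have c3 := (c1.sub c2).abs
    have : ∀ᶠ p : Hn n × Hn n in 𝓝 (z, ζ),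
        |k (gmul (ginv p.2) p.1) - k (gmul (ginv p.2) z)| < ε / (2 * (v + 1)) :=
      c3.eventually_lt_const (by
        change |k (gmul (ginv ζ) z) - k (gmul (ginv ζ) z)| < _
        rw [sub_self, abs_zero]; positivity)
    exact this.mono fun p hp => hp.le
  filter_upwards [key, hS.isClosed.isOpen_compl.mem_nhds hz] with z' h1 h2
  rw [Real.dist_eq, rpot, rpot, ← integral_sub (integrableOn_kernel hk hS h2)
    (integrableOn_kernel hk hS hz)]
  have h3 := norm_setIntegral_le_of_norm_le_const (μ := volume) hS.measure_lt_top
    fun ζ hζ => (Real.norm_eq_abs _).trans_le (h1 ζ hζ)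
  rw [Real.norm_eq_abs] at h3
  refine h3.trans_lt ?_
  change ε / (2 * (v + 1)) * v < ε
  rw [div_mul_eq_mul_div, div_lt_iff₀ (by positivity)]
  nlinarith

/-- By associativity, right multiplication by an increment commutes with the left translation by
`ζ⁻¹`, so the second difference falls on the kernel. -/
lemma secDiff_rpot (hk : ContinuousOn k {0}ᶜ) (hS : IsCompact S) {z : Hn n} (hz : z ∉ S)
    {B : Mat n} {s : ℝ} (h1 : ∀ l, gmul z (s • row B l, 0) ∉ S)
    (h2 : ∀ l, gmul z ((-s) • row B l, 0) ∉ S) :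
    IntegrableOn (fun ζ => secDiff B k (gmul (ginv ζ) z) s) S ∧
      secDiff B (rpot k S) z s = ∫ ζ in S, secDiff B k (gmul (ginv ζ) z) s := by
  have i0 := integrableOn_kernel hk hS hz
  have hi : ∀ l, IntegrableOn (fun ζ => k (gmul (gmul (ginv ζ) z) (s • row B l, 0))
      + k (gmul (gmul (ginv ζ) z) ((-s) • row B l, 0)) - 2 * k (gmul (ginv ζ) z)) S := by
    intro l
    have i1 := integrableOn_kernel hk hS (h1 l)
    have i2 := integrableOn_kernel hk hS (h2 l)
    simp only [← gmul_assoc] at i1 i2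
    exact (i1.add i2).sub (i0.const_mul 2)
  refine ⟨integrable_finsetSum _ fun l _ => hi l, ?_⟩
  simp only [secDiff]
  rw [integral_finsetSum _ fun l _ => hi l]
  refine Finset.sum_congr rfl fun l _ => ?_
  have i1 := integrableOn_kernel hk hS (h1 l)
  have i2 := integrableOn_kernel hk hS (h2 l)
  simp only [← gmul_assoc] at i1 i2
  calc rpot k S (gmul z (s • row B l, 0)) + rpot k S (gmul z ((-s) • row B l, 0)) - 2 * rpot k S z
      = (∫ ζ in S, k (gmul (gmul (ginv ζ) z) (s • row B l, 0)))
        + (∫ ζ in S, k (gmul (gmul (ginv ζ) z) ((-s) • row B l, 0)))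
        - ∫ ζ in S, 2 * k (gmul (ginv ζ) z) := by
        rw [integral_const_mul]; simp only [rpot, gmul_assoc]
    _ = _ := by
        rw [← integral_add i1 i2]
        exact (integral_sub (i1.add i2) (i0.const_mul 2)).symm

/-- Off `S` the points `ζ⁻¹ ∘ z` range over a compact set avoiding the kernel's singularity. The
locally uniform bounds become one uniform bound there, which is then integrated over `S`. -/
lemma isSubAt_rpot (hk : ContinuousOn k {0}ᶜ) (hS : IsCompact S) {z : Hn n} (hz : z ∉ S)
    {B : Mat n} (hB : ∀ w ≠ 0, ∀ η > 0, ∀ᶠ p : ℝ × Hn n in 𝓝 (0, w),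
      -(η * p.1 ^ 2) ≤ secDiff B k p.2 p.1) :
    IsSubAt B (rpot k S) z := by
  intro η hη
  set v := volume.real S with hv
  have hv0 : 0 ≤ v := measureReal_nonneg
  have hc : IsCompact ((fun ζ => gmul (ginv ζ) z) '' S) :=
    hS.image (show Continuous fun ζ : Hn n => gmul (ginv ζ) z by fun_prop)
  have key : ∀ᶠ s : ℝ in 𝓝 0, ∀ w ∈ (fun ζ => gmul (ginv ζ) z) '' S,
      -(η / (v + 1) * s ^ 2) ≤ secDiff B k w s := by
    refine hc.eventually_forall_of_forall_eventually ?_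
    rintro _ ⟨ζ, hζ, rfl⟩
    exact hB _ (gmul_ginv_ne_zero hz hζ) _ (by positivity)
  have hout : ∀ l, ∀ c : ℝ, ∀ᶠ s : ℝ in 𝓝 0, gmul z ((c * s) • row B l, 0) ∉ S := by
    intro l c
    have hc : Continuous fun s : ℝ => gmul z ((c * s) • row B l, (0 : ℝ)) := by fun_prop
    have : Tendsto (fun s : ℝ => gmul z ((c * s) • row B l, (0 : ℝ))) (𝓝 0) (𝓝 z) := by
      have := hc.tendsto 0
      simpa [gmul_zero, ← Prod.zero_eq_mk] using this
    exact this.eventually (hS.isClosed.isOpen_compl.mem_nhds hz)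
  filter_upwards [key, eventually_all.2 fun l => hout l 1, eventually_all.2 fun l => hout l (-1)]
    with s h1 h2 h3
  simp only [one_mul, neg_one_mul] at h2 h3
  obtain ⟨hi, he⟩ := secDiff_rpot hk hS hz h2 h3
  rw [he]
  have hconst : IntegrableOn (fun _ : Hn n => -(η / (v + 1) * s ^ 2)) S :=
    integrableOn_const hS.measure_lt_top.ne
  have hmono := setIntegral_mono_on hconst hi hS.measurableSet
    fun ζ hζ => h1 _ (mem_image_of_mem _ hζ)
  rw [setIntegral_const, ← hv, smul_eq_mul] at hmono
  refine le_trans ?_ hmono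
  rw [mul_neg, neg_le_neg_iff]
  have : v * (η / (v + 1)) ≤ η := by
    rw [mul_div_assoc', div_le_iff₀ (by positivity)]
    nlinarith
  calc v * (η / (v + 1) * s ^ 2) = v * (η / (v + 1)) * s ^ 2 := by ring
    _ ≤ η * s ^ 2 := by gcongr

lemma IsGauge.pot_eq_ofReal {a b α : ℝ} {φ : Hn n → ℝ} (h : IsGauge a b φ)
    (hS : IsCompact S) {z : Hn n} (hz : z ∉ S) :
    IsGauge.pot φ α S z = ENNReal.ofReal (rpot (fun w => φ w ^ (-α)) S z) := by
  have hk : ContinuousOn (fun w => φ w ^ (-α)) {0}ᶜ :=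
    h.cont.continuousOn.rpow_const fun w hw => Or.inl (h.pos_of_ne hw).ne'
  rw [rpot, ofReal_integral_eq_lintegral_ofReal (integrableOn_kernel hk hS hz)
    (ae_of_all _ fun ζ => Real.rpow_nonneg (h.nonneg _) _)]
  rfl

lemma IsGauge.rpot_nonneg {a b α : ℝ} {φ : Hn n → ℝ} (h : IsGauge a b φ) (z : Hn n) :
    0 ≤ rpot (fun w => φ w ^ (-α)) S z :=
  integral_nonneg fun _ => Real.rpow_nonneg (h.nonneg _) _

/-- The comparison principle: a supersolution `u` on the ball of radius `r` dominates a subsolution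
`h` that is at most `1`, lies below `u` on the boundary, and is a subsolution where `u < 3/4`. -/
lemma comparison {z₀ : Hn n} {r : ℝ} (hr : 0 < r) {U : Set (Hn n)} (hU : IsOpen U)
    (hrU : {w | kdist z₀ w ≤ r} ⊆ U) {u h : Hn n → ℝ} {A : Hn n → Mat n}
    (hu : ContDiffOn ℝ 2 u U) (hu0 : ∀ z ∈ U, 0 ≤ u z) (hLu : ∀ z ∈ U, opL A u z ≤ 0)
    (hA : ∀ z ∈ U, (A z).PosSemidef) (htr : ∀ z ∈ U, 0 < (A z).trace)
    (hcont : ∀ z ∈ U, u z ≤ 3 / 4 → ContinuousAt h z)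
    (hh1 : ∀ z ∈ U, u z ≤ 3 / 4 → h z ≤ 1)
    (hbd : ∀ z, kdist z₀ z = r → u z ≤ 3 / 4 → h z ≤ 0)
    (hsub : ∀ z ∈ kball z₀ r, u z < 3 / 4 → ∀ B : Mat n, A z = Bᵀ * B → IsSubAt B h z)
    {z₁ : Hn n} (hz₁ : z₁ ∈ kball z₀ r) (huz₁ : u z₁ < 1 / 2) : h z₁ < 7 / 8 := by
  by_contra! hz₁h
  -- Makes the penalty at most `1/16` on the closed ball of radius `r`.
  set γ : ℝ := 1 / (16 * r ^ 2) with hγ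
  have hγ0 : 0 < γ := by positivity
  set v : Hn n → ℝ := fun w => u w - h w - γ * ‖w.1 - z₀.1‖ ^ 2 with hv
  have hnorm : ∀ w, kdist z₀ w ≤ r → γ * ‖w.1 - z₀.1‖ ^ 2 ≤ 1 / 16 := by
    intro w hw
    have h1 : ‖w.1 - z₀.1‖ ≤ r := by
      have := norm_fst_le_rho (gmul (ginv z₀) w)
      have e : (gmul (ginv z₀) w).1 = w.1 - z₀.1 := by simp [gmul, ginv]; abel
      rw [e] at this
      exact this.trans hw
    calc γ * ‖w.1 - z₀.1‖ ^ 2 ≤ γ * r ^ 2 := by gcongr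
      _ = 1 / 16 := by rw [hγ]; field_simp
  set K : Set (Hn n) := {w | kdist z₀ w ≤ r} ∩ {w | u w ≤ 3 / 4} with hK
  have hKc : IsCompact K := by
    have hcl : IsClosed K := by
      exact (hu.continuousOn.mono hrU).preimage_isClosed_of_isClosed
        (isCompact_kdist_le z₀ r).isClosed isClosed_Iic
    exact (isCompact_kdist_le z₀ r).of_isClosed_subset hcl inter_subset_left
  have hz₁K : z₁ ∈ K := ⟨le_of_lt (show kdist z₀ z₁ < r from hz₁), by rw [mem_ofPred_eq]; linarith⟩
  have hvc : ContinuousOn v K := by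
    intro w hw
    have hwU := hrU hw.1
    have c1 : ContinuousAt u w := hu.continuousOn.continuousAt (hU.mem_nhds hwU)
    have c2 := hcont w hwU hw.2
    have c3 : ContinuousAt (fun w : Hn n => γ * ‖w.1 - z₀.1‖ ^ 2) w :=
      Continuous.continuousAt (by fun_prop)
    exact ((c1.sub c2).sub c3).continuousWithinAt
  obtain ⟨z, hzK, hzmin⟩ := hKc.exists_isMinOn ⟨z₁, hz₁K⟩ hvc
  have hv1 : v z ≤ v z₁ := hzmin hz₁K
  -- From `u z₁ < 1/2` and `h z₁ ≥ 7/8`. On the sphere `v ≥ -1/16`, and where `u = 3/4` one has `v ≥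
  -- 3/4 - 1 - 1/16 = -5/16`; both exceed `-3/8`, so the minimum over `K` is a genuine local
  -- minimum.
  have hv1' : v z < -(3 / 8) := by
    have : 0 ≤ γ * ‖z₁.1 - z₀.1‖ ^ 2 := by positivity
    have e : v z₁ = u z₁ - h z₁ - γ * ‖z₁.1 - z₀.1‖ ^ 2 := rfl
    linarith
  have e : v z = u z - h z - γ * ‖z.1 - z₀.1‖ ^ 2 := rfl
  have hzn := hnorm z hzK.1
  have hzU := hrU hzK.1
  have hzr : kdist z₀ z < r := by
    refine lt_of_le_of_ne hzK.1 fun heq => ?_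
    have := hbd z heq hzK.2
    have := hu0 z hzU
    linarith
  have hzu : u z < 3 / 4 := by
    refine lt_of_le_of_ne hzK.2 fun heq => ?_
    have := hh1 z hzU hzK.2
    linarith
  have huz : ContinuousAt u z := hu.continuousOn.continuousAt (hU.mem_nhds hzU)
  have hKn : K ∈ 𝓝 z := by
    refine inter_mem ?_ ?_
    · exact mem_of_superset ((isOpen_kball z₀ r).mem_nhds hzr) fun w (hw : kdist z₀ w < r) => hw.le
    · filter_upwards [huz.eventually_lt_const hzu] with w hw using hw.le
  obtain ⟨B, hB⟩ := exists_transpose_mul_self (hA z hzU)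
  refine not_isLocalMin_sub (x₀ := z₀.1) (B := B) (by rw [← hB]; exact htr z hzU)
    (hu.contDiffAt (hU.mem_nhds hzU)) (by rw [← hB]; exact hLu z hzU)
    (hsub z hzr hzu B hB) hγ0 (hzmin.isLocalMin hKn)

end

/-! ### Elliptic symplectic matrices and the subsolution property of the kernel -/

section

/-- The linear map of a matrix. -/
def op (M : Mat n) : EuclideanSpace ℝ (Fin n ⊕ Fin n) →L[ℝ] EuclideanSpace ℝ (Fin n ⊕ Fin n) :=
  Matrix.toEuclideanCLM (𝕜 := ℝ) M

lemma op_apply (M : Mat n) (x : EuclideanSpace ℝ (Fin n ⊕ Fin n)) :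
    op M x = WithLp.toLp 2 (M *ᵥ WithLp.ofLp x) := rfl

lemma op_sub (A M : Mat n) : op (A - M) = op A - op M := map_sub _ _ _

lemma op_mul_apply (A M : Mat n) (x : EuclideanSpace ℝ (Fin n ⊕ Fin n)) :
    op (A * M) x = op A (op M x) := by
  simp [op_apply, Matrix.mulVec_mulVec]

lemma op_one_apply (x : EuclideanSpace ℝ (Fin n ⊕ Fin n)) : op (1 : Mat n) x = x := by
  simp [op_apply]

lemma inner_op_comm {M : Mat n} (hM : M.IsSymm) (x y : EuclideanSpace ℝ (Fin n ⊕ Fin n)) :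
    inner ℝ (op M x) y = inner ℝ (op M y) x := by
  rw [inner_eq_dotProduct, inner_eq_dotProduct, op_apply, op_apply]
  simp only
  rw [dotProduct_comm, Matrix.dotProduct_mulVec, ← Matrix.mulVec_transpose, hM.eq]

/-- The matrix `M` is symmetric with `lam I ≤ M ≤ Lam I`. -/
structure IsElliptic (lam Lam : ℝ) (M : Mat n) : Prop where
  symm : M.IsSymm
  lower : (M - lam • (1 : Mat n)).PosSemidef
  upper : (Lam • (1 : Mat n) - M).PosSemidef

variable {lam Lam : ℝ} {M A : Mat n}

lemma MemM.isElliptic {Ω : Set (Hn n)} {A : Hn n → Mat n} (h : MemM lam Lam Ω A) {z : Hn n}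
    (hz : z ∈ Ω) : IsElliptic lam Lam (A z) :=
  ⟨h.symm z hz, h.lower z hz, h.upper z hz⟩

namespace IsElliptic

lemma inner_nonneg_of_posSemidef (hM : M.PosSemidef) (x : EuclideanSpace ℝ (Fin n ⊕ Fin n)) :
    0 ≤ inner ℝ (op M x) x := by
  have := hM.dotProduct_mulVec_nonneg (WithLp.ofLp x)
  rw [inner_eq_dotProduct, dotProduct_comm]
  simpa [op_apply] using this

lemma le_inner (h : IsElliptic lam Lam M) (x : EuclideanSpace ℝ (Fin n ⊕ Fin n)) :
    lam * ‖x‖ ^ 2 ≤ inner ℝ (op M x) x := by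
  have := inner_nonneg_of_posSemidef h.lower x
  have e : op (lam • (1 : Mat n)) x = lam • x := by simp [op_apply, Matrix.smul_mulVec]
  rw [op_sub, sub_apply, e, inner_sub_left, real_inner_smul_left,
    real_inner_self_eq_norm_sq] at this
  linarith

lemma inner_le (h : IsElliptic lam Lam M) (x : EuclideanSpace ℝ (Fin n ⊕ Fin n)) :
    inner ℝ (op M x) x ≤ Lam * ‖x‖ ^ 2 := by
  have := inner_nonneg_of_posSemidef h.upper x
  have e : op (Lam • (1 : Mat n)) x = Lam • x := by simp [op_apply, Matrix.smul_mulVec]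
  rw [op_sub, sub_apply, e, inner_sub_left, real_inner_smul_left,
    real_inner_self_eq_norm_sq] at this
  linarith

lemma norm_op_le (h : IsElliptic lam Lam M) (hlam : 0 < lam) (hLam : lam ≤ Lam)
    (x : EuclideanSpace ℝ (Fin n ⊕ Fin n)) : ‖op M x‖ ≤ Lam * ‖x‖ := by
  have hL : 0 < Lam := hlam.trans_le hLam
  have h1 := h.inner_le (op M x)
  -- Testing the form of `M` on `Lam x - M x` and bounding its top-order term by `h1` gives `Lam
  -- ‖Mx‖² ≤ Lam² ⟨Mx, x⟩`, with no spectral theory.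
  have h2 := (mul_nonneg hlam.le (sq_nonneg _)).trans (h.le_inner (Lam • x - op M x))
  have h3 := h.inner_le x
  rw [map_sub, map_smul, inner_sub_left, inner_sub_right, inner_sub_right, real_inner_smul_left,
    real_inner_smul_left, real_inner_smul_right, real_inner_smul_right, inner_op_comm h.symm (op M x) x,
    real_inner_self_eq_norm_sq] at h2
  have h4 : Lam * ‖op M x‖ ^ 2 ≤ Lam ^ 2 * (Lam * ‖x‖ ^ 2) := by nlinarith [sq_nonneg Lam]
  have h5 : ‖op M x‖ ^ 2 ≤ (Lam * ‖x‖) ^ 2 := by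
    refine le_of_mul_le_mul_left ?_ hL
    rw [mul_pow]; linarith
  exact (pow_le_pow_iff_left₀ (norm_nonneg _) (by positivity) (by norm_num)).1 h5

lemma posSemidef (h : IsElliptic lam Lam M) (hlam : 0 < lam) : M.PosSemidef := by
  have := h.lower.add (Matrix.PosSemidef.one.smul hlam.le)
  rwa [sub_add_cancel] at this

lemma trace_pos (h : IsElliptic lam Lam M) (hlam : 0 < lam) (hn : 1 ≤ n) : 0 < M.trace := by
  have := h.lower.trace_nonneg
  rw [Matrix.trace_sub, Matrix.trace_smul, Matrix.trace_one] at this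
  simp only [Fintype.card_sum, Fintype.card_fin, smul_eq_mul, sub_nonneg] at this
  refine lt_of_lt_of_le ?_ this
  have : (0 : ℝ) < n := by exact_mod_cast hn
  push_cast
  positivity

end IsElliptic

lemma op_inv_of_isSymplectic (h : IsSymplectic M) (x : EuclideanSpace ℝ (Fin n ⊕ Fin n)) :
    op M⁻¹ x = -Jvec (op M (Jvec x)) := by
  rw [IsSymplectic, Matrix.J_transpose] at h
  rw [h, op_mul_apply, op_mul_apply]
  simp [op_apply, Jvec, Matrix.neg_mulVec]

/-- The symplectic condition makes `M⁻¹` the conjugate of `M` by an isometry, so `M⁻¹` inherits the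
bounds `lam` and `Lam` themselves. -/
lemma inner_op_inv (h : IsSymplectic M) (x y : EuclideanSpace ℝ (Fin n ⊕ Fin n)) :
    inner ℝ (op M⁻¹ x) y = inner ℝ (op M (Jvec x)) (Jvec y) := by
  rw [op_inv_of_isSymplectic h, inner_neg_left, inner_Jvec_left, neg_neg, real_inner_comm]

lemma phi_eq (M : Mat n) (z : Hn n) : phi M z = inner ℝ (op M⁻¹ z.1) z.1 ^ 2 + z.2 ^ 2 := by
  rw [phi, inner_eq_dotProduct]; rfl

lemma contDiff_phi (M : Mat n) : ContDiff ℝ 2 (phi M) := by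
  have : phi M = fun z : Hn n => inner ℝ (op M⁻¹ z.1) z.1 ^ 2 + z.2 ^ 2 := funext (phi_eq M)
  rw [this]
  have h1 : ContDiff ℝ 2 fun z : Hn n => op M⁻¹ z.1 := (op M⁻¹).contDiff.comp contDiff_fst
  exact ((h1.inner ℝ contDiff_fst).pow 2).add (contDiff_snd.pow 2)

/-- The gauge constants depend only on `lam` and `Lam`; this is why the final `ε` depends on neither
the matrix field nor `ω`. -/
lemma isGauge_phi (h : IsElliptic lam Lam M) (hs : IsSymplectic M) (hlam : 0 < lam) :
    IsGauge (min (lam ^ 2) 1) (max (Lam ^ 2) 1) (phi M) where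
  cont := (contDiff_phi M).continuous
  dil R z := by
    simp only [phi_eq, dil_apply, map_smul, real_inner_smul_left, real_inner_smul_right]; ring
  even z := by simp [phi_eq, ginv]
  pos := by positivity
  lower z := by
    have h1 := h.le_inner (Jvec z.1)
    rw [← inner_op_inv hs, norm_Jvec] at h1
    have h2 : (lam * ‖z.1‖ ^ 2) ^ 2 ≤ inner ℝ (op M⁻¹ z.1) z.1 ^ 2 :=
      pow_le_pow_left₀ (by positivity) h1 2
    rw [phi_eq, rho_pow_four, mul_add]
    refine add_le_add (le_trans ?_ h2) ?_
    · rw [mul_pow, ← pow_mul]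
      exact mul_le_mul_of_nonneg_right (min_le_left _ _) (by positivity)
    · exact mul_le_of_le_one_left (sq_nonneg _) (min_le_right _ _)
  upper z := by
    have h0 := (mul_nonneg hlam.le (sq_nonneg _)).trans (h.le_inner (Jvec z.1))
    have h1 := h.inner_le (Jvec z.1)
    rw [← inner_op_inv hs] at h0
    rw [← inner_op_inv hs, norm_Jvec] at h1
    have h2 : inner ℝ (op M⁻¹ z.1) z.1 ^ 2 ≤ (Lam * ‖z.1‖ ^ 2) ^ 2 :=
      pow_le_pow_left₀ h0 h1 2
    rw [phi_eq, rho_pow_four, mul_add]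
    refine add_le_add (h2.trans ?_) ?_
    · rw [mul_pow, ← pow_mul]
      exact mul_le_mul_of_nonneg_right (le_max_left _ _) (by positivity)
    · exact le_mul_of_one_le_left (sq_nonneg _) (le_max_right _ _)

lemma expo_eq (n : ℕ) (δ : ℝ) : expo n δ = n / 2 + δ := by unfold expo homDim; ring

lemma contDiffAt_kernelG {δ : ℝ} {ζ : Hn n} (h : phi M ζ ≠ 0) :
    ContDiffAt ℝ 2 (kernelG M δ) ζ :=
  contDiffAt_const.mul ((contDiff_phi M).contDiffAt.rpow_const_of_ne h)

/-- The second derivative along a line determines the second Fréchet derivative on the diagonal. -/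
lemma fderiv_fderiv_eq_of_line {E : Type*} [NormedAddCommGroup E] [NormedSpace ℝ E] {ψ : E → ℝ}
    {z d : E} (hψ : ContDiffAt ℝ 2 ψ z) {g' : ℝ → ℝ} {c : ℝ}
    (h1 : ∀ᶠ s in 𝓝 (0 : ℝ), HasDerivAt (fun s => ψ (z + s • d)) (g' s) s)
    (h2 : HasDerivAt g' c 0) : fderiv ℝ (fderiv ℝ ψ) z d d = c := by
  have hl : ∀ s : ℝ, HasDerivAt (fun s : ℝ => z + s • d) d s := fun s => by
    simpa using ((hasDerivAt_id s).smul_const d).const_add z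
  have ht : Tendsto (fun s : ℝ => z + s • d) (𝓝 0) (𝓝 z) := by
    simpa using (hl 0).continuousAt.tendsto
  have hd : ∀ᶠ s in 𝓝 (0 : ℝ), DifferentiableAt ℝ ψ (z + s • d) :=
    ht.eventually ((hψ.eventually (by simp)).mono fun x hx => hx.differentiableAt (by simp))
  have heq : g' =ᶠ[𝓝 0] fun s => fderiv ℝ ψ (z + s • d) d := by
    filter_upwards [h1, hd] with s hs1 hs2
    exact hs1.unique (hs2.hasFDerivAt.comp_hasDerivAt s (hl s))
  have h3 : HasFDerivAt (fderiv ℝ ψ) (fderiv ℝ (fderiv ℝ ψ) z) (z + (0 : ℝ) • d) := by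
    rw [zero_smul, add_zero]
    exact ((hψ.fderiv_right (m := 1) (by norm_num)).differentiableAt (by simp)).hasFDerivAt
  have h4 : HasDerivAt (fun s : ℝ => fderiv ℝ ψ (z + s • d)) (fderiv ℝ (fderiv ℝ ψ) z d) 0 :=
    h3.comp_hasDerivAt (f := fun s : ℝ => z + s • d) (0 : ℝ) (hl 0)
  have h6 : HasDerivAt (fun s : ℝ => fderiv ℝ ψ (z + s • d) d) (fderiv ℝ (fderiv ℝ ψ) z d d) 0 := by
    have := h4.clm_apply (hasDerivAt_const (0 : ℝ) d)
    rwa [map_zero, add_zero] at this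
  exact (h6.congr_of_eventuallyEq heq).unique h2

/-- Restricted to the line through `z` along `hvec b z`, `φ` is an explicit quartic polynomial `f`.
The factor `-1/α` normalizes the first derivative to `f^{-α-1} f'`. -/
lemma fderiv_fderiv_kernelG (hs : (M⁻¹).IsSymm) {δ : ℝ} (hα : expo n δ ≠ 0) {z : Hn n}
    (hz : 0 < phi M z) (b : EuclideanSpace ℝ (Fin n ⊕ Fin n)) :
    fderiv ℝ (fderiv ℝ (kernelG M δ)) z (hvec b z) (hvec b z)
      = phi M z ^ (-expo n δ - 1) * (8 * inner ℝ (op M⁻¹ z.1) b ^ 2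
          + 4 * inner ℝ (op M⁻¹ z.1) z.1 * inner ℝ (op M⁻¹ b) b + 8 * inner ℝ (Jvec z.1) b ^ 2)
        - (expo n δ + 1) * phi M z ^ (-expo n δ - 2) * (16 * inner ℝ
          (inner ℝ (op M⁻¹ z.1) z.1 • op M⁻¹ z.1 + z.2 • Jvec z.1) b ^ 2) := by
  set q := inner ℝ (op M⁻¹ z.1) z.1 with hq
  set p := inner ℝ (op M⁻¹ z.1) b with hp
  set m := inner ℝ (op M⁻¹ b) b with hm
  set j := inner ℝ (Jvec z.1) b with hj
  set α := expo n δ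
  set f : ℝ → ℝ := fun s => (q + s * (2 * p) + s ^ 2 * m) ^ 2 + (z.2 + s * (2 * j)) ^ 2 with hf
  set f' : ℝ → ℝ := fun s => 2 * (q + s * (2 * p) + s ^ 2 * m) * (2 * p + 2 * s * m)
    + 2 * (z.2 + s * (2 * j)) * (2 * j) with hf'
  have hline : ∀ s, phi M (z + s • hvec b z) = f s := by
    intro s
    rw [phi_eq]
    have e1 : (z + s • hvec b z).1 = z.1 + s • b := rfl
    have e2 : (z + s • hvec b z).2 = z.2 + s * (2 * j) := rfl
    rw [e1, e2, map_add, map_smul, inner_add_left, inner_add_right, inner_add_right,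
      real_inner_smul_left, real_inner_smul_left, real_inner_smul_right, real_inner_smul_right,
      inner_op_comm hs b z.1, ← hq, ← hp, ← hm, hf]
    ring
  have hf0 : f 0 = phi M z := by rw [← hline 0, zero_smul, add_zero]
  have df : ∀ s, HasDerivAt f (f' s) s := by
    intro s
    have i1 : HasDerivAt (fun s : ℝ => s) 1 s := hasDerivAt_id s
    have a1 := (((i1.mul_const (2 * p)).const_add q).add ((i1.pow 2).mul_const m)).pow 2
    have a2 := ((i1.mul_const (2 * j)).const_add z.2).pow 2
    refine (a1.add a2).congr_deriv ?_
    simp only [hf', Pi.add_apply, Pi.pow_apply]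
    push_cast
    ring
  have df' : HasDerivAt f' (8 * p ^ 2 + 4 * q * m + 8 * j ^ 2) 0 := by
    have i1 : HasDerivAt (fun s : ℝ => s) 1 (0 : ℝ) := hasDerivAt_id _
    have a1 := ((((i1.mul_const (2 * p)).const_add q).add ((i1.pow 2).mul_const m)).const_mul 2).mul
      (((i1.const_mul 2).mul_const m).const_add (2 * p))
    have a2 := (((i1.mul_const (2 * j)).const_add z.2).const_mul 2).mul_const (2 * j)
    refine (a1.add a2).congr_deriv ?_
    simp
    ring
  have hpos : ∀ᶠ s in 𝓝 (0 : ℝ), 0 < f s := by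
    have : ContinuousAt f 0 := (df 0).continuousAt
    exact this.eventually_const_lt (by rwa [hf0])
  have hψ : ContDiffAt ℝ 2 (kernelG M δ) z := contDiffAt_kernelG hz.ne'
  refine fderiv_fderiv_eq_of_line (g' := fun s => f s ^ (-α - 1) * f' s) hψ ?_ ?_
  · filter_upwards [hpos] with s hs
    have := ((df s).rpow_const (p := -α) (Or.inl hs.ne')).const_mul (-(1 / α))
    refine (this.congr_of_eventuallyEq (Eventually.of_forall fun s => ?_)).congr_deriv ?_
    · simp only [kernelG, hline]; rfl
    · field_simp
  · have h1 := (df 0).rpow_const (p := -α - 1) (Or.inl (by rw [hf0]; exact hz.ne'))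
    refine (h1.mul df').congr_deriv ?_
    have e1 : f' 0 = 4 * inner ℝ (q • op M⁻¹ z.1 + z.2 • Jvec z.1) b := by
      rw [inner_add_left, real_inner_smul_left, real_inner_smul_left, ← hp, ← hj]
      simp only [hf']; ring
    rw [hf0, e1, show -α - 1 - 1 = -α - 2 by ring]
    ring

lemma sum_inner_row_sq (B : Mat n) (v w : EuclideanSpace ℝ (Fin n ⊕ Fin n)) :
    ∑ l, inner ℝ v (row B l) * inner ℝ w (row B l) = inner ℝ (op (Bᵀ * B) v) w := by
  have h : ∀ u l, inner ℝ u (row B l) = (B *ᵥ WithLp.ofLp u) l := fun u l => by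
    rw [inner_eq_dotProduct, dotProduct_comm]; rfl
  simp only [h]
  rw [op_mul_apply, inner_eq_dotProduct, op_apply, op_apply]
  simp only
  rw [dotProduct_comm, Matrix.dotProduct_mulVec, ← Matrix.mulVec_transpose, Matrix.transpose_transpose,
    dotProduct_comm]
  rfl

lemma sum_inner_op_row (B N : Mat n) :
    ∑ l, inner ℝ (op N (row B l)) (row B l) = Matrix.trace (Bᵀ * B * N) := by
  rw [Matrix.mul_assoc, Matrix.trace_mul_comm, Matrix.trace]
  refine Finset.sum_congr rfl fun l _ => ?_
  rw [inner_eq_dotProduct, op_apply, row, Matrix.diag, Matrix.mul_assoc, Matrix.mul_apply']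
  simp only
  rw [dotProduct_comm]
  congr 1

lemma abs_trace_mul_le {C N : Mat n} {κ L : ℝ} (hC : ‖op C‖ ≤ κ)
    (hN : ∀ x, ‖op N x‖ ≤ L * ‖x‖) : |Matrix.trace (C * N)| ≤ 2 * n * (κ * L) := by
  have h : ∀ i, |(C * N) i i| ≤ κ * L := by
    intro i
    have e : (C * N) i i = inner ℝ (op C (op N (EuclideanSpace.single i 1)))
        (EuclideanSpace.single i 1) := by
      rw [← op_mul_apply, inner_eq_dotProduct, op_apply]
      simp
    rw [e]
    refine (abs_real_inner_le_norm _ _).trans ?_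
    have h1 := hN (EuclideanSpace.single i (1 : ℝ))
    have h2 := (op C).le_of_opNorm_le hC (op N (EuclideanSpace.single i (1 : ℝ)))
    have hκ : 0 ≤ κ := (norm_nonneg _).trans hC
    simp only [PiLp.norm_single, norm_one, mul_one] at h1 ⊢
    exact h2.trans (by gcongr)
  calc |Matrix.trace (C * N)| ≤ ∑ i, |(C * N) i i| := Finset.abs_sum_le_sum_abs _ _
    _ ≤ ∑ _i : Fin n ⊕ Fin n, κ * L := Finset.sum_le_sum fun i _ => h i
    _ = 2 * n * (κ * L) := by
        rw [Finset.sum_const, Finset.card_univ, Fintype.card_sum, Fintype.card_fin, nsmul_eq_mul]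
        push_cast; ring

lemma trace_mul_horHess_kernelG (hs : (M⁻¹).IsSymm) {δ : ℝ} (hα : expo n δ ≠ 0) {z : Hn n}
    (hz : 0 < phi M z) (hA : A.PosSemidef) :
    Matrix.trace (A * horHess (kernelG M δ) z)
      = phi M z ^ (-expo n δ - 2) * (phi M z * (8 * inner ℝ (op A (op M⁻¹ z.1)) (op M⁻¹ z.1)
          + 4 * inner ℝ (op M⁻¹ z.1) z.1 * Matrix.trace (A * M⁻¹)
          + 8 * inner ℝ (op A (Jvec z.1)) (Jvec z.1))
        - 16 * (expo n δ + 1) * (inner ℝ (op M⁻¹ z.1) z.1 ^ 2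
            * inner ℝ (op A (op M⁻¹ z.1)) (op M⁻¹ z.1)
          + 2 * inner ℝ (op M⁻¹ z.1) z.1 * z.2 * inner ℝ (op A (op M⁻¹ z.1)) (Jvec z.1)
          + z.2 ^ 2 * inner ℝ (op A (Jvec z.1)) (Jvec z.1))) := by
  obtain ⟨B, rfl⟩ := exists_transpose_mul_self hA
  rw [trace_mul_horHess (contDiffAt_kernelG hz.ne') B]
  simp only [fderiv_fderiv_kernelG hs hα hz]
  have hp : phi M z ^ (-expo n δ - 1) = phi M z ^ (-expo n δ - 2) * phi M z := by
    rw [← Real.rpow_add_one hz.ne']; ring_nf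
  rw [hp, ← sum_inner_row_sq, ← sum_inner_row_sq, ← sum_inner_row_sq, ← sum_inner_op_row]
  simp only [Finset.mul_sum, ← Finset.sum_add_distrib, ← Finset.sum_sub_distrib]
  refine Finset.sum_congr rfl fun l _ => ?_
  rw [inner_add_left, real_inner_smul_left, real_inner_smul_left]
  ring

/-- The perturbation constant. -/
def pertConst (n : ℕ) (lam Lam δ : ℝ) : ℝ :=
  (32 * (expo n δ + 1) + 16) * ((Lam ^ 2 + Lam + 1) / lam) + 8 * n * Lam

/-- In the unperturbed case `a1 = a3 = q`, `a2 = 0`, `τ = 2N`, the left side is `φq(16 + 8N -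
16(α+1)) = -16δφq`. All deviations are bounded by `κφq` times a constant, and the last hypothesis
says this margin covers them. -/
lemma perturbation_le {φ q t a1 a2 a3 τ κ C N Lam α δ : ℝ} (hφ : 0 ≤ φ) (hφeq : φ = q ^ 2 + t ^ 2)
    (hq0 : 0 ≤ q) (hα : 0 < α) (hαe : α = N / 2 + δ)
    (e1 : |a1 - q| ≤ κ * (C * q)) (e2 : |a2| ≤ κ * (C * q)) (e3 : |a3 - q| ≤ κ * (C * q))
    (e4 : |τ - 2 * N| ≤ 2 * N * (κ * Lam))
    (hκδ : κ * ((32 * (α + 1) + 16) * C + 8 * N * Lam) ≤ 16 * δ) :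
    φ * (8 * a1 + 4 * q * τ + 8 * a3)
      - 16 * (α + 1) * (q ^ 2 * a1 + 2 * q * t * a2 + t ^ 2 * a3) ≤ 0 := by
  have f1 := abs_le.1 e1
  have f3 := abs_le.1 e3
  have f4 := abs_le.1 e4
  set E := κ * (C * q) with hE
  have g1 : φ * (8 * a1 + 4 * q * τ + 8 * a3)
      ≤ φ * (16 * q + 8 * N * q + 16 * E + 8 * N * (κ * Lam) * q) := by
    refine mul_le_mul_of_nonneg_left ?_ hφ
    have : q * τ ≤ q * (2 * N + 2 * N * (κ * Lam)) :=
      mul_le_mul_of_nonneg_left (by linarith [f4.2]) hq0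
    linarith [f1.2, f3.2]
  have g2 : φ * q - 2 * φ * E ≤ q ^ 2 * a1 + 2 * q * t * a2 + t ^ 2 * a3 := by
    have h1 : q ^ 2 * (q - E) ≤ q ^ 2 * a1 :=
      mul_le_mul_of_nonneg_left (by linarith [f1.1]) (sq_nonneg q)
    have h3 : t ^ 2 * (q - E) ≤ t ^ 2 * a3 :=
      mul_le_mul_of_nonneg_left (by linarith [f3.1]) (sq_nonneg t)
    have h2 : -(φ * E) ≤ 2 * q * t * a2 := by
      refine (abs_le.1 ?_).1
      rw [abs_mul]
      refine mul_le_mul ?_ e2 (abs_nonneg _) hφ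
      rw [hφeq]
      refine abs_le.2 ⟨by linarith [sq_nonneg (q + t)], by linarith [sq_nonneg (q - t)]⟩
    rw [hφeq] at h2 ⊢
    linarith
  have g3 : 16 * (α + 1) * (φ * q - 2 * φ * E)
      ≤ 16 * (α + 1) * (q ^ 2 * a1 + 2 * q * t * a2 + t ^ 2 * a3) :=
    mul_le_mul_of_nonneg_left g2 (by positivity)
  have g4 : φ * q * (κ * ((32 * (α + 1) + 16) * C + 8 * N * Lam)) ≤ φ * q * (16 * δ) :=
    mul_le_mul_of_nonneg_left hκδ (by positivity)
  have g5 : φ * (16 * q + 8 * N * q + 16 * E + 8 * N * (κ * Lam) * q)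
      - 16 * (α + 1) * (φ * q - 2 * φ * E)
      = φ * q * (κ * ((32 * (α + 1) + 16) * C + 8 * N * Lam)) - φ * q * (16 * δ) := by
    rw [hE, hαe]; ring
  linarith

lemma trace_mul_horHess_kernelG_nonpos (hlam : 0 < lam) (hLam : lam ≤ Lam) {δ : ℝ}
    (hδ : 0 < δ) (hM : IsElliptic lam Lam M) (hdet : M.det = 1) (hs : IsSymplectic M)
    (hA : A.PosSemidef) {κ : ℝ} (hκ : ‖op (A - M)‖ ≤ κ) (hκδ : κ * pertConst n lam Lam δ ≤ 16 * δ)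
    {z : Hn n} (hz : z ≠ 0) :
    Matrix.trace (A * horHess (kernelG M δ) z) ≤ 0 := by
  have hL : 0 < Lam := hlam.trans_le hLam
  have hκ0 : 0 ≤ κ := (norm_nonneg _).trans hκ
  have hα : 0 < expo n δ := by rw [expo_eq]; positivity
  have hφ : 0 < phi M z := (isGauge_phi hM hs hlam).pos_of_ne hz
  have hunit : IsUnit M.det := by rw [hdet]; exact isUnit_one
  have hMi : (M⁻¹).IsSymm := by
    rw [Matrix.IsSymm, Matrix.transpose_nonsing_inv, hM.symm.eq]
  rw [trace_mul_horHess_kernelG hMi hα.ne' hφ hA]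
  refine mul_nonpos_of_nonneg_of_nonpos (by positivity) ?_
  set x := z.1
  set t := z.2
  set Nx := op M⁻¹ x with hNx
  set q := inner ℝ Nx x with hq
  have hMN : op M Nx = x := by
    rw [hNx, ← op_mul_apply, Matrix.mul_nonsing_inv _ hunit, op_one_apply]
  -- Symplecticity makes the forms of `M` at `Jx` and at `M⁻¹x` both equal to `q`, and `⟨x, Jx⟩ = 0`
  -- kills the cross term: the unperturbed values needed by `perturbation_le`.
  have hqeq : inner ℝ (op M (Jvec x)) (Jvec x) = q := (inner_op_inv hs x x).symm
  have hql : lam * ‖x‖ ^ 2 ≤ q := by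
    have := hM.le_inner (Jvec x)
    rwa [hqeq, norm_Jvec] at this
  have hq0 : 0 ≤ q := (by positivity : 0 ≤ lam * ‖x‖ ^ 2).trans hql
  have hN : ∀ y, ‖op M⁻¹ y‖ ≤ Lam * ‖y‖ := fun y => by
    rw [op_inv_of_isSymplectic hs, norm_neg, norm_Jvec]
    simpa [norm_Jvec] using hM.norm_op_le hlam hLam (Jvec y)
  have hNn : ‖Nx‖ ≤ Lam * ‖x‖ := hN x
  have pert : ∀ v w, |inner ℝ (op A v) w - inner ℝ (op M v) w| ≤ κ * (‖v‖ * ‖w‖) := by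
    intro v w
    rw [← inner_sub_left, ← sub_apply, ← op_sub, ← mul_assoc]
    refine (abs_real_inner_le_norm _ _).trans ?_
    gcongr
    exact (op (A - M)).le_of_opNorm_le hκ v
  have hxx : ‖x‖ * ‖x‖ ≤ q / lam := by
    rw [le_div_iff₀ hlam]; nlinarith
  -- One constant dominating the three factors `Lam²`, `Lam` and `1` that arise from `e1`, `e2`,
  -- `e3`.
  set C := (Lam ^ 2 + Lam + 1) / lam with hC
  have hC0 : 0 < C := by positivity
  have bd : ∀ c, c ≤ Lam ^ 2 + Lam + 1 → 0 ≤ c → κ * (c * (‖x‖ * ‖x‖)) ≤ κ * (C * q) := by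
    intro c hc hc0
    refine mul_le_mul_of_nonneg_left ?_ hκ0
    calc c * (‖x‖ * ‖x‖) ≤ (Lam ^ 2 + Lam + 1) * (q / lam) := by gcongr
      _ = C * q := by rw [hC]; ring
  have e1 : |inner ℝ (op A Nx) Nx - q| ≤ κ * (C * q) := by
    have := pert Nx Nx
    rw [hMN, real_inner_comm Nx x, ← hq] at this
    refine this.trans (le_trans ?_ (bd (Lam ^ 2) (by linarith) (by positivity)))
    refine mul_le_mul_of_nonneg_left ?_ hκ0
    calc ‖Nx‖ * ‖Nx‖ ≤ (Lam * ‖x‖) * (Lam * ‖x‖) := by gcongr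
      _ = _ := by ring
  have e2 : |inner ℝ (op A Nx) (Jvec x)| ≤ κ * (C * q) := by
    have := pert Nx (Jvec x)
    rw [hMN, real_inner_comm (Jvec x) x, inner_Jvec_self, sub_zero, norm_Jvec] at this
    refine this.trans (le_trans ?_ (bd Lam (by nlinarith [sq_nonneg Lam]) hL.le))
    refine mul_le_mul_of_nonneg_left ?_ hκ0
    calc ‖Nx‖ * ‖x‖ ≤ (Lam * ‖x‖) * ‖x‖ := by gcongr
      _ = _ := by ring
  have e3 : |inner ℝ (op A (Jvec x)) (Jvec x) - q| ≤ κ * (C * q) := by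
    have := pert (Jvec x) (Jvec x)
    rw [hqeq, norm_Jvec] at this
    refine this.trans (le_trans (le_of_eq ?_) (bd 1 (by nlinarith [sq_nonneg Lam]) zero_le_one))
    ring
  have e4 : |Matrix.trace (A * M⁻¹) - 2 * n| ≤ 2 * n * (κ * Lam) := by
    have := abs_trace_mul_le hκ hN
    rw [Matrix.sub_mul, Matrix.trace_sub, Matrix.mul_nonsing_inv _ hunit, Matrix.trace_one] at this
    simpa [two_mul] using this
  exact perturbation_le hφ.le (phi_eq M z) hq0 hα (expo_eq n δ) e1 e2 e3 e4
    hκδ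

lemma norm_op_sub_le {Ω : Set (Hn n)} {ω : ℝ → ℝ} {A : Hn n → Mat n} (hω : IsModulus ω)
    (hA : MemC Ω ω A) {z₀ z : Hn n} (hz₀ : z₀ ∈ Ω) (hz : z ∈ Ω) {s : ℝ} (hs : 0 < s)
    (hs1 : s < 1) (hd : z ∈ kball z₀ s) : ‖op (A z - A z₀)‖ ≤ ω s := by
  have h := hA.modulus_le z₀ hz₀ s hs hs1
  have h1 : ENNReal.ofReal ‖op (A z - A z₀)‖ ≤ modulus Ω A z₀ s :=
    le_iSup₂ (f := fun z (_ : z ∈ kball z₀ s ∩ Ω) =>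
      ENNReal.ofReal ‖Matrix.toEuclideanCLM (𝕜 := ℝ) (A z - A z₀)‖) z ⟨hd, hz⟩
  exact (ENNReal.ofReal_le_ofReal_iff (hω.mapsTo ⟨hs.le, hs1⟩).1).1 (h1.trans h)

/-- Any radius at which `ω` falls below `16δ / pertConst` works, and this choice does not involve
`Ω`. -/
theorem exists_isSubsolutionRadius (n : ℕ) {lam Lam δ : ℝ} (hlam : 0 < lam) (hLam : lam ≤ Lam)
    (hδ : 0 < δ) {ω : ℝ → ℝ} (hω : IsModulus ω) :
    ∃ ε₀ : ℝ, 0 < ε₀ ∧ ∀ Ω : Set (Hn n), IsOpen Ω → IsSubsolutionRadius lam Lam δ ω Ω ε₀ := by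
  have hL : 0 < Lam := hlam.trans_le hLam
  have hα : 0 < expo n δ := by rw [expo_eq]; positivity
  have hP : 0 < pertConst n lam Lam δ := by unfold pertConst; positivity
  have hev := hω.tendsto.eventually_lt_const
    (show 0 < 16 * δ / pertConst n lam Lam δ by positivity)
  obtain ⟨s, hs, hs0, hs1⟩ := (hev.and (Ioo_mem_nhdsGT (zero_lt_one' ℝ))).exists
  refine ⟨s, hs0, fun Ω _ A hM hC z₀ hz₀ hsymp z hz ζ hζ => ?_⟩
  rw [neg_nonneg]
  refine trace_mul_horHess_kernelG_nonpos hlam hLam hδ (hM.isElliptic hz₀)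
    (hM.det_eq_one z₀ hz₀) hsymp ((hM.isElliptic hz.2).posSemidef hlam)
    (norm_op_sub_le hω hC hz₀ hz.2 hs0 hs1 hz.1) ?_ hζ
  rw [lt_div_iff₀ hP] at hs
  exact hs.le

end

/-! ### Normalized potentials and the critical density estimate -/

lemma IsSubAt.affine {B : Mat n} {f : Hn n → ℝ} {z : Hn n} (h : IsSubAt B f z) {c : ℝ}
    (hc : 0 < c) (m : ℝ) : IsSubAt B (fun w => c * (f w - m)) z := by
  intro η hη
  filter_upwards [h (η / c) (by positivity)] with s hs
  have hconst : secDiff B (fun _ => m) z s = 0 := by simp only [secDiff]; ring_nf; simp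
  rw [secDiff_const_mul, secDiff_sub, hconst, sub_zero]
  calc -(η * s ^ 2) = c * (-(η / c * s ^ 2)) := by field_simp
    _ ≤ _ := by gcongr

/-- Potentials of large subsets of a small gauge ball almost attain their maximal value at the
centre of the ball, and are small at a distance. -/
lemma exists_potential_bounds (n : ℕ) {a b α : ℝ} (ha : 0 < a) (hb : 0 < b) (hα0 : 0 < α)
    (hα : α < ((n : ℝ) + 1) / 2) :
    ∃ ε : ℝ, 0 < ε ∧ ε < 1 ∧ ∀ φ : Hn n → ℝ, IsGauge a b φ → ∀ r : ℝ, 0 < r → ∀ z₀ z₁ : Hn n,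
      ∃ θ : ℝ, IsGauge.gball φ z₁ θ ⊆ {ζ | kdist ζ z₁ ≤ r / 4} ∧
        ∀ S : Set (Hn n), IsCompact S → S ⊆ IsGauge.gball φ z₁ θ →
          volume (IsGauge.gball φ z₁ θ \ S) ≤ ENNReal.ofReal ε * volume (kball z₀ r) →
          ∃ m D : ℝ, 0 < D ∧ (∀ z ∉ S, rpot (fun w => φ w ^ (-α)) S z ≤ m + D) ∧
            (∀ z ∉ S, (∀ ζ ∈ S, r / 4 ≤ kdist ζ z) → rpot (fun w => φ w ^ (-α)) S z ≤ m) ∧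
            (z₁ ∉ S → m + 7 / 8 * D ≤ rpot (fun w => φ w ^ (-α)) S z₁) := by
  set β := ((n : ℝ) + 1) / 2 with hβ
  set g := β - α with hg
  have hg0 : 0 < g := by linarith
  set C := IsGauge.shellConst n α with hC
  have hC0 : 0 < C := IsGauge.shellConst_pos hα
  -- Chosen so that `σ^α = 1/2`: shrinking the gauge level from `T` to `θ = σT` halves the far-field
  -- bound relative to `P`.
  set σ : ℝ := 2 ^ (-(1 / α)) with hσ
  have hσ0 : 0 < σ := by positivity
  have hσ1 : σ ≤ 1 := Real.rpow_le_one_of_one_le_of_nonpos (by norm_num)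
    (by rw [neg_nonpos]; positivity)
  have hσα : σ ^ α = 1 / 2 := by
    rw [hσ, ← Real.rpow_mul (by norm_num), neg_mul, one_div_mul_cancel hα0.ne',
      Real.rpow_neg (by norm_num), Real.rpow_one, one_div]
  -- The integral of the kernel over the level `κθ` is then at most `P/32`.
  set κ : ℝ := (1 / (32 * C)) ^ (1 / g) with hκ
  have hκ0 : 0 < κ := by positivity
  have hκg : C * κ ^ g = 1 / 32 := by
    rw [hκ, ← Real.rpow_mul (by positivity), one_div_mul_cancel hg0.ne', Real.rpow_one]
    field_simp
  -- The cost, in units of `P`, of a removed set of measure `|B_r|` outside the level `κθ`. The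
  -- factor `256 = 4⁴` comes from the radius `r/4`, and `ε ≤ 1/(32Y)` brings the cost down to
  -- `P/32`.
  set Y : ℝ := κ ^ (-α) * (256 * b / (a * σ)) ^ β with hY
  have hY0 : 0 < Y := by positivity
  refine ⟨min (1 / 2) (1 / (32 * Y)), by positivity,
    (min_le_left _ _).trans_lt (by norm_num), fun φ hφ r hr z₀ z₁ => ?_⟩
  set ε := min (1 / 2) (1 / (32 * Y)) with hε
  have hε0 : 0 < ε := by positivity
  have hεY : Y * ε ≤ 1 / 32 := by
    calc Y * ε ≤ Y * (1 / (32 * Y)) := by gcongr; exact min_le_right _ _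
      _ = 1 / 32 := by field_simp
  set T := a * (r / 4) ^ 4 with hT
  have hT0 : 0 < T := by positivity
  set θ := σ * T with hθ
  have hθ0 : 0 < θ := by positivity
  have hball : IsGauge.gball φ z₁ θ ⊆ {ζ | kdist ζ z₁ ≤ r / 4} := fun ζ hζ =>
    hφ.gball_subset (by positivity) (le_trans hζ (mul_le_of_le_one_left hT0.le hσ1))
  refine ⟨θ, hball, fun S hS hSG hvol => ?_⟩
  set V := volume {z | φ z ≤ 1}
  set c := V.toReal with hc
  have hV : V = ENNReal.ofReal c := (ENNReal.ofReal_toReal hφ.volume_one_ne_top).symm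
  have hc0 : 0 < c := ENNReal.toReal_pos hφ.volume_one_ne_zero hφ.volume_one_ne_top
  set P := θ ^ g * c with hP
  have hP0 : 0 < P := by positivity
  set L := ∫⁻ w in {z | φ z ≤ θ}, IsGauge.ker φ α w with hL
  have hL1 : L ≤ ENNReal.ofReal (C * θ ^ g) * V := hφ.lintegral_ker_le hα0 hα hθ0
  have hL2 : ENNReal.ofReal (θ ^ g) * V ≤ L := hφ.le_lintegral_ker hα0 hθ0
  rw [hV, ← ENNReal.ofReal_mul (by positivity)] at hL1 hL2
  have hLfin : L ≠ ∞ := ne_top_of_le_ne_top ENNReal.ofReal_ne_top hL1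
  set I := L.toReal with hI
  have hLI : L = ENNReal.ofReal I := (ENNReal.ofReal_toReal hLfin).symm
  have hPI : P ≤ I := (ENNReal.ofReal_le_iff_le_toReal hLfin).1 hL2
  have hnn : ∀ z, 0 ≤ rpot (fun w => φ w ^ (-α)) S z := hφ.rpot_nonneg
  have hSm := hS.measurableSet
  have hvG : volume (IsGauge.gball φ z₁ θ) = ENNReal.ofReal (θ ^ β * c) := by
    rw [hφ.volume_gball, hφ.volume_le_eq hθ0, ENNReal.ofReal_mul (by positivity), ← hV]
  have hvS : volume S ≤ ENNReal.ofReal (θ ^ β * c) := (measure_mono hSG).trans_eq hvG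
  -- The maximum is `m + D = I`, the centre value of the full gauge ball, and the far field is at
  -- most `m = P/2`. At the centre the loss is at most `P/16`, and `I - P/16 ≥ m + 7D/8` is exactly
  -- `I ≥ P`.
  refine ⟨P / 2, I - P / 2, by linarith, fun z hz => ?_, fun z hz hfar => ?_, fun hz => ?_⟩
  · have h1 := hφ.pot_le hα0 hθ0 hSm
      (by rw [← hφ.volume_gball z₁ θ]; exact measure_mono hSG) z
    rw [hφ.pot_eq_ofReal hS hz, ← hL, hLI, ENNReal.ofReal_le_ofReal_iff (by linarith)] at h1
    linarith
  · have h1 := IsGauge.pot_le_of_far (φ := φ) hα0 hT0 hSm (z := z) fun ζ hζ => by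
      refine le_trans ?_ (hφ.lower _)
      have := hfar ζ hζ
      rw [hT]
      exact mul_le_mul_of_nonneg_left (pow_le_pow_left₀ (by positivity) this 4) ha.le
    rw [hφ.pot_eq_ofReal hS hz] at h1
    have h2 := h1.trans (mul_le_mul_right hvS _)
    rw [← ENNReal.ofReal_mul (by positivity), ENNReal.ofReal_le_ofReal_iff (by positivity)] at h2
    refine h2.trans_eq ?_
    have e1 : θ ^ β = θ ^ g * (1 / 2 * T ^ α) := by
      rw [← hσα, ← Real.mul_rpow hσ0.le hT0.le, ← hθ, ← Real.rpow_add hθ0]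
      congr 1; rw [hg]; ring
    have e2 : T ^ (-α) * T ^ α = 1 := by rw [← Real.rpow_add hT0]; simp
    rw [e1, hP]
    linear_combination (1 / 2 * θ ^ g * c) * e2
  · have hGm : MeasurableSet (IsGauge.gball φ z₁ θ) := (hφ.isClosed_gball z₁ θ).measurableSet
    have h0 : L ≤ IsGauge.pot φ α S z₁ + IsGauge.pot φ α (IsGauge.gball φ z₁ θ \ S) z₁ := by
      rw [hL, ← hφ.pot_gball α z₁ θ]
      calc _ = ∫⁻ ζ in S ∪ (IsGauge.gball φ z₁ θ \ S), IsGauge.ker φ α (gmul (ginv ζ) z₁) := by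
            rw [union_sdiff_cancel hSG]; rfl
        _ ≤ _ := lintegral_union_le _ _ _
    have h1 := hφ.pot_le_add hα0 (mul_pos hκ0 hθ0) (hGm.diff hSm) z₁
    have h2 := hφ.lintegral_ker_le hα0 hα (mul_pos hκ0 hθ0)
    have h3 : volume (IsGauge.gball φ z₁ θ \ S)
        ≤ ENNReal.ofReal (ε * ((b * r ^ 4) ^ β * c)) := by
      refine hvol.trans ?_
      rw [ENNReal.ofReal_mul hε0.le, ENNReal.ofReal_mul (by positivity), ← hV]
      gcongr
      exact hφ.volume_kball_le z₀ hr
    have h4 : IsGauge.pot φ α (IsGauge.gball φ z₁ θ \ S) z₁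
        ≤ ENNReal.ofReal ((κ * θ) ^ (-α) * (ε * ((b * r ^ 4) ^ β * c))
          + C * (κ * θ) ^ g * c) := by
      refine h1.trans ?_
      rw [ENNReal.ofReal_add (by positivity) (by positivity), ENNReal.ofReal_mul (by positivity),
        ENNReal.ofReal_mul (by positivity : 0 ≤ C * (κ * θ) ^ g), ← hV]
      gcongr
    have e1 : b * r ^ 4 = 256 * b / (a * σ) * θ := by
      rw [hθ, hT]; field_simp; norm_num
    have e2 : (κ * θ) ^ (-α) * (ε * ((b * r ^ 4) ^ β * c)) = Y * ε * P := by
      rw [e1, Real.mul_rpow hκ0.le hθ0.le, Real.mul_rpow (by positivity) hθ0.le, hY, hP, hg,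
        sub_eq_add_neg, Real.rpow_add hθ0]
      ring
    have e3 : C * (κ * θ) ^ g * c = 1 / 32 * P := by
      rw [Real.mul_rpow hκ0.le hθ0.le, hP, ← hκg]; ring
    have h5 : IsGauge.pot φ α (IsGauge.gball φ z₁ θ \ S) z₁ ≤ ENNReal.ofReal (P / 16) := by
      refine h4.trans (ENNReal.ofReal_le_ofReal ?_)
      rw [e2, e3]
      nlinarith
    rw [hφ.pot_eq_ofReal hS hz, hLI] at h0
    have h6 := h0.trans (add_le_add_right h5 _)
    rw [← ENNReal.ofReal_add (hnn z₁) (by positivity),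
      ENNReal.ofReal_le_ofReal_iff (add_nonneg (hnn z₁) (by positivity))] at h6
    linarith

/-- Multiplying by `-α` turns a supersolution bound for `kernelG` into a subsolution bound for the
positive kernel `φ^{-α}`. -/
lemma eventually_le_secDiff_kernel {M A B : Mat n} {δ : ℝ} (hα : 0 < expo n δ) (hAB : A = Bᵀ * B)
    {w : Hn n} (hw : phi M w ≠ 0) (htr : 0 ≤ -Matrix.trace (A * horHess (kernelG M δ) w)) {η : ℝ}
    (hη : 0 < η) :
    ∀ᶠ p : ℝ × Hn n in 𝓝 (0, w),
      -(η * p.1 ^ 2) ≤ secDiff B (fun w => phi M w ^ (-expo n δ)) p.2 p.1 := by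
  rw [hAB, neg_nonneg] at htr
  filter_upwards [eventually_secDiff_le (contDiffAt_kernelG hw) B htr (div_pos hη hα)] with p hp
  have e : secDiff B (kernelG M δ) p.2 p.1
      = -(1 / expo n δ) * secDiff B (fun w => phi M w ^ (-expo n δ)) p.2 p.1 :=
    secDiff_const_mul B _ _ p.2 p.1
  rw [e] at hp
  have h2 := mul_le_mul_of_nonneg_left hp hα.le
  have e2 : expo n δ * (-(1 / expo n δ) * secDiff B (fun w => phi M w ^ (-expo n δ)) p.2 p.1)
      = -secDiff B (fun w => phi M w ^ (-expo n δ)) p.2 p.1 := by field_simp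
  have e3 : expo n δ * (η / expo n δ * p.1 ^ 2) = η * p.1 ^ 2 := by field_simp
  rw [e2, e3] at h2
  linarith

theorem exists_critical_density (n : ℕ) (hn : 1 ≤ n) {lam Lam δ : ℝ} (hlam : 0 < lam)
    (hLam : lam ≤ Lam) (hδ : 0 < δ) (hδ' : δ < 1 / 2) :
    ∃ ε : ℝ, 0 < ε ∧ ε < 1 ∧ ∀ (ω : ℝ → ℝ) (Ω : Set (Hn n)) (ε₀ : ℝ),
      IsSubsolutionRadius lam Lam δ ω Ω ε₀ → ∀ z₀ ∈ Ω, ∀ r : ℝ, 0 < r → r ≤ ε₀ →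
      kball z₀ (eta lam Lam * r) ⊆ Ω → ∀ A : Hn n → Mat n, MemM lam Lam Ω A → MemC Ω ω A →
      IsSymplectic (A z₀) → ∀ u : Hn n → ℝ,
      ContDiffOn ℝ 2 u (kball z₀ (eta lam Lam * r)) →
      (∀ z ∈ kball z₀ (eta lam Lam * r), 0 ≤ u z) →
      (∀ z ∈ kball z₀ (eta lam Lam * r), opL A u z ≤ 0) →
      sInf (u '' kball z₀ (r / 2)) < 1 / 2 →
      ENNReal.ofReal ε * volume (kball z₀ r) ≤ volume {z ∈ kball z₀ r | u z < 1} := by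
  have hL : 0 < Lam := hlam.trans_le hLam
  have hα0 : 0 < expo n δ := by rw [expo_eq]; positivity
  have hα : expo n δ < ((n : ℝ) + 1) / 2 := by rw [expo_eq]; linarith
  obtain ⟨ε, hε0, hε1, hε⟩ := exists_potential_bounds n (a := min (lam ^ 2) 1)
    (b := max (Lam ^ 2) 1) (by positivity) (by positivity) hα0 hα
  refine ⟨ε, hε0, hε1, fun ω Ω ε₀ hrad z₀ hz₀ r hr hrε hsub A hM hC hsymp u hu hu0 hLu hinf => ?_⟩
  by_contra! hcon
  have hφ := isGauge_phi (hM.isElliptic hz₀) hsymp hlam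
  set φ := phi (A z₀)
  set α := expo n δ
  have hη : 1 < eta lam Lam := by
    have : 0 < Real.sqrt (Lam / lam) := Real.sqrt_pos.2 (by positivity)
    unfold eta; linarith
  have hrU : {w | kdist z₀ w ≤ r} ⊆ kball z₀ (eta lam Lam * r) := fun w (hw : kdist z₀ w ≤ r) =>
    show kdist z₀ w < _ from hw.trans_lt (by nlinarith)
  obtain ⟨_, ⟨z₁, hz₁, rfl⟩, huz₁⟩ := exists_lt_of_csInf_lt
    (Set.Nonempty.image u ⟨z₀, show kdist z₀ z₀ < r / 2 by rw [kdist_eq_zero_self]; positivity⟩) hinf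
  have hz₁' : kdist z₀ z₁ < r / 2 := hz₁
  obtain ⟨θ, hθ, hpot⟩ := hε φ hφ r hr z₀ z₁
  set G := IsGauge.gball φ z₁ θ with hG
  have hGd : ∀ ζ ∈ G, kdist z₀ ζ < r := fun ζ hζ => by
    have h1 : kdist ζ z₁ ≤ r / 4 := hθ hζ
    have := kdist_triangle z₀ z₁ ζ
    rw [kdist_comm z₁] at this
    linarith
  have hGU : G ⊆ kball z₀ (eta lam Lam * r) := fun ζ hζ => hrU (hGd ζ hζ).le
  have hGc : IsCompact G := by
    refine (isCompact_kdist_le z₁ (r / 4)).of_isClosed_subset (hφ.isClosed_gball z₁ θ)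
      fun ζ hζ => ?_
    have h1 : kdist ζ z₁ ≤ r / 4 := hθ hζ
    rwa [kdist_comm] at h1
  -- Keeping `u ≥ 1` makes `S` compact and disjoint from `{u ≤ 3/4}`, so the singularities of the
  -- potential never meet the comparison region.
  set S := G ∩ u ⁻¹' Ici 1 with hS
  have hSc : IsCompact S := hGc.of_isClosed_subset
    ((hu.continuousOn.mono hGU).preimage_isClosed_of_isClosed hGc.isClosed isClosed_Ici)
    inter_subset_left
  have hvol : volume (G \ S) ≤ ENNReal.ofReal ε * volume (kball z₀ r) := by
    refine (measure_mono fun ζ hζ => ?_).trans hcon.le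
    exact ⟨hGd ζ hζ.1, not_le.1 fun h => hζ.2 ⟨hζ.1, h⟩⟩
  obtain ⟨m, D, hD, hmax, hfar, hcen⟩ := hpot S hSc inter_subset_left hvol
  have hnS : ∀ z, u z ≤ 3 / 4 → z ∉ S := fun z hz hzS => by
    have : 1 ≤ u z := hzS.2
    linarith
  have hk : ContinuousOn (fun w => φ w ^ (-α)) {0}ᶜ :=
    hφ.cont.continuousOn.rpow_const fun w hw => Or.inl (hφ.pos_of_ne hw).ne'
  set h : Hn n → ℝ := fun z => D⁻¹ * (rpot (fun w => φ w ^ (-α)) S z - m) with hh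
  have hlt : h z₁ < 7 / 8 := by
    refine comparison hr (isOpen_kball z₀ _) hrU hu hu0 hLu
      (fun z hz => (hM.isElliptic (hsub hz)).posSemidef hlam)
      (fun z hz => (hM.isElliptic (hsub hz)).trace_pos hlam hn) (fun z _ hz => ?_)
      (fun z _ hz => ?_) (fun z hzr hz => ?_) (fun z hzr hz B hB => ?_)
      (show kdist z₀ z₁ < r by linarith) huz₁
    · exact continuousAt_const.mul ((continuousAt_rpot hk hSc (hnS z hz)).sub continuousAt_const)
    · rw [hh]
      simp only
      rw [inv_mul_le_iff₀ hD]
      linarith [hmax z (hnS z hz)]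
    -- On the sphere, `z` is at distance at least `r/2` from `z₁`, and `S` lies within `r/4` of
    -- `z₁`; hence `z` is at least `r/4` from `S`.
    · refine mul_nonpos_of_nonneg_of_nonpos (by positivity) (sub_nonpos.2 (hfar z (hnS z hz) ?_))
      intro ζ hζ
      have h1 : kdist ζ z₁ ≤ r / 4 := hθ hζ.1
      have h2 := kdist_triangle z₀ z₁ z
      have h3 := kdist_triangle z₁ ζ z
      rw [kdist_comm z₁ ζ] at h3
      linarith
    · have hzr' : kdist z₀ z < r := hzr
      refine (isSubAt_rpot hk hSc (hnS z hz.le) fun w hw η hη => ?_).affine (inv_pos.2 hD) m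
      -- The coefficients are taken at `z` and the kernel is frozen at `z₀`; `r ≤ ε₀` places `z`
      -- inside the subsolution radius.
      exact eventually_le_secDiff_kernel hα0 hB (hφ.pos_of_ne hw).ne'
        (hrad A hM hC z₀ hz₀ hsymp z
          ⟨show kdist z₀ z < ε₀ by linarith, hsub (hrU hzr'.le)⟩ w hw) hη
  have hge := hcen (hnS z₁ (by linarith))
  have : 7 / 8 ≤ h z₁ := by
    rw [hh]
    simp only
    rw [inv_mul_eq_div, le_div_iff₀ hD]
    linarith
  linarith

end Heisenberg

end

theorem mainTheorem3 (n : ℕ) (hn : 1 ≤ n) (lam Lam δ : ℝ)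
    (hlam : 0 < lam) (hLam : lam ≤ Lam) (hδ : 0 < δ) (hδ' : δ < 1 / 2) :
    ∃ ε : ℝ, 0 < ε ∧ ε < 1 ∧
      ∀ ω : ℝ → ℝ, Heisenberg.IsModulus ω →
        (∃ ε₀ : ℝ, 0 < ε₀ ∧ ∀ Ω : Set (Heisenberg.Hn n), IsOpen Ω →
          Heisenberg.IsSubsolutionRadius lam Lam δ ω Ω ε₀) ∧
        ∀ Ω : Set (Heisenberg.Hn n), IsOpen Ω →
          ∀ ε₀ : ℝ, 0 < ε₀ → Heisenberg.IsSubsolutionRadius lam Lam δ ω Ω ε₀ →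
          ∀ z₀ ∈ Ω, ∀ r : ℝ, 0 < r → r ≤ ε₀ →
          Heisenberg.kball z₀ (Heisenberg.eta lam Lam * r) ⊆ Ω →
          ∀ A : Heisenberg.Hn n → Heisenberg.Mat n,
          Heisenberg.MemM lam Lam Ω A → Heisenberg.MemC Ω ω A →
          (∀ z ∈ Ω, Heisenberg.IsSymplectic (A z)) →
          ∀ u : Heisenberg.Hn n → ℝ,
          ContDiffOn ℝ 2 u (Heisenberg.kball z₀ (Heisenberg.eta lam Lam * r)) →
          (∀ z ∈ Heisenberg.kball z₀ (Heisenberg.eta lam Lam * r), 0 ≤ u z) →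
          (∀ z ∈ Heisenberg.kball z₀ (Heisenberg.eta lam Lam * r), Heisenberg.opL A u z ≤ 0) →
          sInf (u '' Heisenberg.kball z₀ (r / 2)) < 1 / 2 →
          ENNReal.ofReal ε * volume (Heisenberg.kball z₀ r) ≤
            volume {z ∈ Heisenberg.kball z₀ r | u z < 1} := by
  obtain ⟨ε, hε0, hε1, hε⟩ := Heisenberg.exists_critical_density n hn hlam hLam hδ hδ'
  exact ⟨ε, hε0, hε1, fun ω hω =>
    ⟨Heisenberg.exists_isSubsolutionRadius n hlam hLam hδ hω,
      fun Ω _ ε₀ _ hrad z₀ hz₀ r hr hrε hsub A hM hC hsymp =>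
        hε ω Ω ε₀ hrad z₀ hz₀ r hr hrε hsub A hM hC (hsymp z₀ hz₀)⟩⟩
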